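/- Consider, for each $n\in\mathbb N$, a first-come-first-served queue with $n$ servers. At time $0-$ there are $\tilde Q^n_0$ customers in service, with remaining service times $\tilde\eta_1,\tilde\eta_2,\dots\ge 0$, and $\hat Q^n_0$ customers in the queue, whose service times $\hat\eta_1,\hat\eta_2,\dots\ge0$ are i.i.d. with distribution function $\hat F$, $\hat F(0)<1$. The number of exogenous arrivals by time $t$ is $E^n(t)$, a nondecreasing, $\mathbb Z_+$-valued process with right-continuous trajectories with left-hand limits, and the exogenously arriving customers have service times $\eta_1,\eta_2,\dots\ge 0$ that are i.i.d. with distribution function $F$, $F(0)<1$. For each $n$, the entities $\tilde Q_0^n$, $\hat Q_0^n$, $\{\tilde\eta_i\}$, $\{\hat\eta_i\}$, $\{\eta_i\}$, $E^n$ are independent. Let $Q^n(t)$ be the number of customers present at time $t$, $\hat Q^n(t)$ the number of those present at time $0-$ that have not left by time $t$, and $\check A^n(t)$ and $\hat A^n(t)$ the numbers of customers that enter service by time $t$ out of those arriving after $0-$ and out of those queued at $0-$, respectively. That is, $Q^n,\hat Q^n,\check A^n,\hat A^n$ are any $\mathbb Z_+$-valued processes with trajectories in the space $\mathbb D(\mathbb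 R_+,\mathbb R)$ of right-continuous functions with left-hand limits, $\check A^n,\hat A^n$ being nondecreasing, such that, for all $t\ge0$, $$Q^n(t)=\hat Q^n(t)+E^n(t)-\sum_{i=1}^{\check A^n(t)}\mathbf 1_{\{\check\tau^n_i+\eta_i\le t\}},\qquad \check A^n(t)=E^n(t)+(\hat Q^n(t)-n)^+-(Q^n(t)-n)^+,$$ $$\hat Q^n(t)=\hat Q^n_0+\sum_{i=1}^{\tilde Q^n_0}\mathbf 1_{\{\tilde\eta_i>t\}}-\sum_{i=1}^{\hat A^n(t)}\mathbf 1_{\{\hat\tau^n_i+\hat\eta_i\le t\}},\qquad \hat A^n(t)=\hat Q_0^n-(\hat Q^n(t)-n)^+,$$ where $\check\tau^n_i=\inf\{t:\check A^n(t)\ge i\}$ and $\hat\tau^n_i=\inf\{t:\hat A^n(t)\ge i\}$. Let $\hat{\mathbf q}_0,\tilde{\mathbf q}_0\ge0$, let $\mathbf e\in\mathbb D(\mathbb R_+,\mathbb R)$ be nondecreasing, let $\tilde F$ be the distribution function of a nonnegative random variable, and let $\tilde F^n(t)=\frac1n\sum_{i=1}^n\mathbf 1_{\{\tilde\eta_i\le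 t\}}$. Suppose that, for arbitrary $T>0$ and $\varepsilon>0$, as $n\to\infty$, $$\mathbf P\Big(\Big|\frac{\hat Q^n_0}n-\hat{\mathbf q}_0\Big|>\varepsilon\Big)\to0,\quad \mathbf P\Big(\Big|\frac{\tilde Q^n_0}n-\tilde{\mathbf q}_0\Big|>\varepsilon\Big)\to0,\quad \mathbf P\Big(\sup_{t\in[0,T]}|\tilde F^n(t)-\tilde F(t)|>\varepsilon\Big)\to0,\quad \mathbf P\Big(\sup_{t\in[0,T]}\Big|\frac{E^n(t)}n-\mathbf e(t)\Big|>\varepsilon\Big)\to0.$$ Then the fluid equations (with $\int_0^t=\int_{[0,t]}$), for $t\ge0$, $$\mathbf q(t)=\mathbf e(t)-\int_0^t\mathbf e(t-s)\,dF(s)+\hat{\mathbf q}(t)-\int_0^t(\hat{\mathbf q}(t-s)-1)^+dF(s)+\int_0^t(\mathbf q(t-s)-1)^+dF(s),$$ $$\hat{\mathbf q}(t)=\hat{\mathbf q}_0(1-\hat F(t))+\tilde{\mathbf q}_0(1-\tilde F(t))+\int_0^t(\hat{\mathbf q}(t-s)-1)^+d\hat F(s),$$ have a unique solution $(\mathbf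 q,\hat{\mathbf q})$ with $\mathbf q,\hat{\mathbf q}\in\mathbb D(\mathbb R_+,\mathbb R)$, and, with $\check{\mathbf a}(t)=\mathbf e(t)+(\hat{\mathbf q}(t)-1)^+-(\mathbf q(t)-1)^+$ and $\hat{\mathbf a}(t)=\hat{\mathbf q}_0-(\hat{\mathbf q}(t)-1)^+$, for arbitrary $T>0$ and $\varepsilon>0$, as $n\to\infty$, $$\mathbf P\Big(\sup_{t\in[0,T]}\Big|\frac{Q^n(t)}n-\mathbf q(t)\Big|>\varepsilon\Big)\to0,\qquad \mathbf P\Big(\sup_{t\in[0,T]}\Big|\frac{\hat Q^n(t)}n-\hat{\mathbf q}(t)\Big|>\varepsilon\Big)\to0,$$ $$\mathbf P\Big(\sup_{t\in[0,T]}\Big|\frac{\check A^n(t)}n-\check{\mathbf a}(t)\Big|>\varepsilon\Big)\to0,\qquad \mathbf P\Big(\sup_{t\in[0,T]}\Big|\frac{\hat A^n(t)}n-\hat{\mathbf a}(t)\Big|>\varepsilon\Big)\to0.$$ -/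

import Mathlib

open MeasureTheory ProbabilityTheory Filter Topology
open scoped NNReal ENNReal

namespace ManyServerQueue

/-- Right-continuous functions with left-hand limits on `[0, ∞)`. (At `t = 0` the left-limit
condition is void, since `𝓝[<] 0 = ⊥`.) -/
def IsCadlag {U : Type*} [TopologicalSpace U] (f : ℝ≥0 → U) : Prop :=
  ∀ t, ContinuousWithinAt f (Set.Ici t) t ∧ ∃ l, Tendsto f (𝓝[<] t) (𝓝 l)

/-- `τ_i = inf {t ≥ 0 : A(t) ≥ i}`, the time of the `i`-th entry into service when `A(t)` counts
the entries by time `t`. It is only used for `i` with `i ≤ A(t)` for some `t`. -/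
noncomputable def entryTime (A : ℝ≥0 → ℕ) (i : ℕ) : ℝ≥0 :=
  sInf {t | i ≤ A t}

/-- The number of departures by time `t` among the customers entering service according to `A`,
`∫₀ᵗ ∫₀ᵗ 1_{s+x ≤ t} d ∑_{i=1}^{A(s)} 1_{η_i ≤ x} = ∑_{i=1}^{A(t)} 1_{τ_i + η_i ≤ t}`.
Service times are indexed from `0`: the `(i+1)`-st customer to enter has service time `η i`. -/
noncomputable def departures (A : ℝ≥0 → ℕ) (η : ℕ → ℝ≥0) (t : ℝ≥0) : ℕ :=
  ∑ i ∈ Finset.range (A t), if entryTime A (i + 1) + η i ≤ t then 1 else 0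

/-- The number of customers, among `k` initially in service with remaining service times
`η 0, …, η (k-1)`, that are still in service at time `t`. -/
noncomputable def stillInService (k : ℕ) (η : ℕ → ℝ≥0) (t : ℝ≥0) : ℕ :=
  ∑ i ∈ Finset.range k, if t < η i then 1 else 0

/-- The empirical distribution function of `η 0, …, η (n-1)`. -/
noncomputable def empiricalCDF (n : ℕ) (η : ℕ → ℝ≥0) (t : ℝ≥0) : ℝ :=
  (∑ i ∈ Finset.range n, if η i ≤ t then (1 : ℝ) else 0) / n

/-- One trajectory of the `n`-server queue. Data: `E` (exogenous arrivals), `Qh₀` (number queued at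
time `0-`), `Qt₀` (number in service at time `0-`), and the service times `η` of the exogenous
customers, `ηh` of the initially queued ones, `ηt` (remaining) of those initially in service.
Unknowns: `Q` (number present), `Qh` (number present out of those present at time `0-`), `Ac`
and `Ah` (entries into service of exogenous, respectively initially queued, customers). -/
structure IsQueuePath (n : ℕ) (E : ℝ≥0 → ℕ) (Qh₀ Qt₀ : ℕ) (η ηh ηt : ℕ → ℝ≥0)
    (Q Qh Ac Ah : ℝ≥0 → ℕ) : Prop where
  cadlag_Q : IsCadlag Q
  cadlag_Qh : IsCadlag Qh
  cadlag_Ac : IsCadlag Ac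
  cadlag_Ah : IsCadlag Ah
  monotone_Ac : Monotone Ac
  monotone_Ah : Monotone Ah
  eq_Q : ∀ t, (Q t : ℝ) = Qh t + E t - departures Ac η t
  eq_Ac : ∀ t, (Ac t : ℝ) = E t + max ((Qh t : ℝ) - n) 0 - max ((Q t : ℝ) - n) 0
  eq_Qh : ∀ t, (Qh t : ℝ) = Qh₀ + stillInService Qt₀ ηt t - departures Ah ηh t
  eq_Ah : ∀ t, (Ah t : ℝ) = Qh₀ - max ((Qh t : ℝ) - n) 0

/-- `∫₀ᵗ g(t - s) dF(s)`, the integral being over `[0, t]` (on which subtraction in `ℝ≥0` is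
ordinary subtraction), for the distribution `F` of a nonnegative random variable. -/
noncomputable def convol (g : ℝ≥0 → ℝ) (F : Measure ℝ≥0) (t : ℝ≥0) : ℝ :=
  ∫ s in Set.Iic t, g (t - s) ∂F

/-- The distribution function of the distribution `F` on `[0, ∞)`. -/
noncomputable def distFun (F : Measure ℝ≥0) (t : ℝ≥0) : ℝ :=
  F.real (Set.Iic t)

/-- The pair `(q, qh)` is a solution in `𝔻(ℝ₊, ℝ)` of the fluid equations with data
`e, qh₀, qt₀` and distributions `F, Fh, Ft`. -/
structure IsFluidSolution (e : ℝ≥0 → ℝ) (qh₀ qt₀ : ℝ≥0) (F Fh Ft : Measure ℝ≥0)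
    (q qh : ℝ≥0 → ℝ) : Prop where
  cadlag_q : IsCadlag q
  cadlag_qh : IsCadlag qh
  eq_q : ∀ t, q t = e t - convol e F t + qh t - convol (fun u => max (qh u - 1) 0) F t
    + convol (fun u => max (q u - 1) 0) F t
  eq_qh : ∀ t, qh t = qh₀ * (1 - distFun Fh t) + qt₀ * (1 - distFun Ft t)
    + convol (fun u => max (qh u - 1) 0) Fh t

/-- Convergence in probability, uniformly on compact time intervals, of the processes `X n` to the
function `x`: `P(sup_{t ∈ [0,T]} |X n t - x t| > ε) → 0` for all `T, ε > 0`. The supremum is taken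
in `[0, ∞]`. -/
def TendstoUCP {Ω : Type*} [MeasurableSpace Ω] (P : Measure Ω) (X : ℕ → Ω → ℝ≥0 → ℝ)
    (x : ℝ≥0 → ℝ) : Prop :=
  ∀ T : ℝ≥0, 0 < T → ∀ ε : ℝ≥0, 0 < ε →
    Tendsto (fun n => P {ω | (ε : ℝ≥0∞) < ⨆ t ∈ Set.Iic T, ‖X n ω t - x t‖ₑ}) atTop (𝓝 0)

end ManyServerQueue

open ManyServerQueue

/-! Substituting the balance equation for entries into service turns both fluid equations into
Volterra equations `x = z + (x - 1)⁺ * F`: the one for `qh` is closed, and the one for `q` is of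
this form once `qh` is known. Since `x ↦ (x - 1)⁺` is 1-Lipschitz and `F` is not concentrated at
`0`, the right-hand side is a contraction for the norm `sup e^{-t}|x t|` on `[0, T]`, with constant
the Laplace transform of `F` at `1`. This gives existence (`volterra_exists`), uniqueness, and a
Lipschitz dependence of `x` on `z` (`volterra_stability`).

The scaled queue satisfies the same equations up to an error, so by stability it suffices that the
error is small. Its main part is the difference between the departures and the convolution of the
entry process with the service law (`withHighProb_departures`). The entry process may depend on the
service times, so the bound is proved for all nondecreasing càdlàg counting paths `A` at once, on a
single event of high probability. Customer `i` has left by `t` exactly when `η i` lies in the lower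
set `C i = departureSet A t i`; departures are `∑ 1_{C i}(η i)` and the convolution is `∑ F(C i)`.
The sets `C i` decrease in `i`. Cut the indices into blocks of length a small fraction of `n`.
Within a block, `C i` is squeezed between its values at the two ends, and a Glivenko–Cantelli law,
uniform over lower sets and initial segments (`withHighProb_count`), handles each fixed set. The
squeezing errors telescope to at most one block length (`abs_sum_indicator_sub_le`). -/

namespace ManyServerQueue

/-! ### Càdlàg functions: algebra, measurability, local boundedness, uniform limits -/

section Cadlag

variable {U V W : Type*} [TopologicalSpace U] [TopologicalSpace V] [TopologicalSpace W]

theorem IsCadlag.comp_continuous {f : ℝ≥0 → U} (hf : IsCadlag f) {g : U → V} (hg : Continuous g) :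
    IsCadlag fun t => g (f t) := fun t =>
  ⟨hg.continuousAt.comp_continuousWithinAt (hf t).1,
    (hf t).2.imp' g fun l hl => (hg.tendsto l).comp hl⟩

theorem IsCadlag.map₂ {f : ℝ≥0 → U} {g : ℝ≥0 → V} (hf : IsCadlag f) (hg : IsCadlag g)
    {φ : U → V → W} (hφ : Continuous fun p : U × V => φ p.1 p.2) :
    IsCadlag fun t => φ (f t) (g t) := by
  have : IsCadlag fun t => (f t, g t) := fun t =>
    ⟨(hf t).1.prodMk (hg t).1,
      let ⟨l, hl⟩ := (hf t).2; let ⟨m, hm⟩ := (hg t).2; ⟨(l, m), hl.prodMk_nhds hm⟩⟩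
  exact this.comp_continuous hφ

theorem isCadlag_const (c : U) : IsCadlag fun _ => c := fun _ =>
  ⟨continuousWithinAt_const, c, tendsto_const_nhds⟩

theorem IsCadlag.natCast {f : ℝ≥0 → ℕ} (hf : IsCadlag f) : IsCadlag fun t => (f t : ℝ) :=
  hf.comp_continuous continuous_of_discreteTopology

theorem IsCadlag.add {f g : ℝ≥0 → ℝ} (hf : IsCadlag f) (hg : IsCadlag g) :
    IsCadlag fun t => f t + g t := hf.map₂ hg continuous_add

theorem IsCadlag.sub {f g : ℝ≥0 → ℝ} (hf : IsCadlag f) (hg : IsCadlag g) :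
    IsCadlag fun t => f t - g t := hf.map₂ hg continuous_sub

theorem IsCadlag.const_mul {f : ℝ≥0 → ℝ} (hf : IsCadlag f) (c : ℝ) :
    IsCadlag fun t => c * f t := hf.comp_continuous (continuous_const_mul c)

theorem IsCadlag.div_const {f : ℝ≥0 → ℝ} (hf : IsCadlag f) (c : ℝ) :
    IsCadlag fun t => f t / c := hf.comp_continuous (g := fun x => x / c) (by fun_prop)

theorem IsCadlag.posPart_sub_one {f : ℝ≥0 → ℝ} (hf : IsCadlag f) :
    IsCadlag fun t => max (f t - 1) 0 :=
  hf.comp_continuous (g := fun x => max (x - 1) 0) (by fun_prop)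

theorem IsCadlag.measurable {f : ℝ≥0 → ℝ} (hf : IsCadlag f) : Measurable f := by
  -- Grid points strictly to the right of `t`: `f ∘ s n` factors through `ℕ`, and right-continuity
  -- gives `f (s n t) → f t`.
  let s : ℕ → ℝ≥0 → ℝ≥0 := fun n t => (⌊t * (n + 1)⌋₊ + 1) / (n + 1)
  have hs : ∀ t, Tendsto (fun n => s n t) atTop (𝓝[≥] t) := by
    intro t
    have hlow : ∀ n, t ≤ s n t := fun n => by
      rw [le_div_iff₀ (by positivity)]
      exact (Nat.lt_floor_add_one _).le
    refine tendsto_nhdsWithin_iff.2 ⟨?_, .of_forall hlow⟩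
    have hup : ∀ n, s n t ≤ t + 1 / (n + 1) := fun n => by
      simp only [s]
      rw [add_div]
      gcongr
      exact div_le_of_le_mul₀ (by positivity) (by positivity) (Nat.floor_le (by positivity))
    have hlim : Tendsto (fun n : ℕ => t + 1 / ((n : ℝ≥0) + 1)) atTop (𝓝 (t + 0)) :=
      tendsto_const_nhds.add tendsto_one_div_add_atTop_nhds_zero_nat
    rw [add_zero] at hlim
    exact tendsto_of_tendsto_of_tendsto_of_le_of_le tendsto_const_nhds hlim hlow hup
  refine measurable_of_tendsto_metrizable (f := fun n t => f (s n t)) (fun n => ?_)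
    (tendsto_pi_nhds.2 fun t => (hf t).1.tendsto.comp (hs t))
  have : (fun t => f (s n t)) =
      (fun k : ℕ => f (((k : ℝ≥0) + 1) / (n + 1))) ∘ fun t : ℝ≥0 => ⌊t * (n + 1)⌋₊ := rfl
  rw [this]
  exact (measurable_of_countable _).comp (Nat.measurable_floor.comp (measurable_id.mul_const _))

theorem IsCadlag.exists_bound {f : ℝ≥0 → ℝ} (hf : IsCadlag f) (T : ℝ≥0) :
    ∃ M, 0 ≤ M ∧ ∀ t ≤ T, |f t| ≤ M := by
  have hc : IsCompact (Set.Iic T) := by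
    rw [← Set.Icc_bot]; exact isCompact_Icc
  suffices h : ∃ M, ∀ t ∈ Set.Iic T, |f t| ≤ M by
    obtain ⟨M, hM⟩ := h
    exact ⟨M, (abs_nonneg _).trans (hM T Set.self_mem_Iic), hM⟩
  refine hc.induction_on (p := fun s => ∃ M, ∀ t ∈ s, |f t| ≤ M) ⟨0, by simp⟩ ?_ ?_ ?_
  · rintro s t hst ⟨M, hM⟩
    exact ⟨M, fun u hu => hM u (hst hu)⟩
  · rintro s t ⟨M, hM⟩ ⟨N, hN⟩
    exact ⟨max M N, fun u hu => hu.elim (fun h => (hM u h).trans (le_max_left _ _))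
      fun h => (hN u h).trans (le_max_right _ _)⟩
  · intro t _
    obtain ⟨hr, l, hl⟩ := hf t
    have h1 : ∀ᶠ u in 𝓝[≥] t, |f u| ≤ |f t| + |l| + 1 := by
      filter_upwards [hr.tendsto.abs.eventually_le_const (lt_add_one |f t|)] with u hu
      have := abs_nonneg l
      linarith
    have h2 : ∀ᶠ u in 𝓝[<] t, |f u| ≤ |f t| + |l| + 1 := by
      filter_upwards [hl.abs.eventually_le_const (lt_add_one |l|)] with u hu
      have := abs_nonneg (f t)
      linarith
    have h3 : ∀ᶠ u in 𝓝 t, |f u| ≤ |f t| + |l| + 1 := by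
      rw [← nhdsLT_sup_nhdsGE t]
      exact Filter.eventually_sup.2 ⟨h2, h1⟩
    exact ⟨_, mem_nhdsWithin_of_mem_nhds h3, _, fun u hu => hu⟩

/-- A locally uniform limit of càdlàg functions is càdlàg. -/
theorem isCadlag_of_locally_uniform_approx {f : ℝ≥0 → ℝ}
    (h : ∀ T : ℝ≥0, ∀ ε > 0, ∃ g : ℝ≥0 → ℝ, IsCadlag g ∧ ∀ t ≤ T, |f t - g t| < ε) :
    IsCadlag f := by
  have key : ∀ (t : ℝ≥0) (F : Filter ℝ≥0), F ≤ 𝓝 t →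
      (∀ g : ℝ≥0 → ℝ, IsCadlag g → ∃ l, Tendsto g F (𝓝 l)) → ∃ l, Tendsto f F (𝓝 l) := by
    intro t F hF hg
    -- The trivial filter does occur, as `𝓝[<] 0`.
    rcases F.eq_or_neBot with rfl | _
    · exact ⟨0, tendsto_bot⟩
    have hb : ∀ᶠ u in F, u ≤ t + 1 := hF (Iic_mem_nhds (by simp))
    refine cauchy_map_iff_exists_tendsto.1 ((Metric.cauchy_iff).2 ⟨inferInstance, fun ε hε => ?_⟩)
    obtain ⟨g, hgc, hfg⟩ := h (t + 1) (ε / 3) (by positivity)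
    obtain ⟨l, hl⟩ := hg g hgc
    obtain ⟨s, hs, hs'⟩ := (Metric.cauchy_iff.1 (hl.cauchy_map)).2 (ε / 3) (by positivity)
    refine ⟨f '' ({u | u ≤ t + 1} ∩ g ⁻¹' s), image_mem_map (inter_mem hb hs), ?_⟩
    rintro _ ⟨u, ⟨hu, hus⟩, rfl⟩ _ ⟨v, ⟨hv, hvs⟩, rfl⟩
    have h1 := hfg u hu
    have h2 := hfg v hv
    have h3 := hs' _ hus _ hvs
    rw [Real.dist_eq, abs_lt] at *
    constructor <;> linarith
  intro t
  refine ⟨?_, key t _ nhdsWithin_le_nhds fun g hg => (hg t).2⟩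
  obtain ⟨l, hl⟩ := key t (𝓝[≥] t) nhdsWithin_le_nhds fun g hg => ⟨_, (hg t).1⟩
  have : l = f t := by
    have := hl.mono_left (pure_le_nhdsWithin (Set.self_mem_Ici))
    exact (tendsto_nhds_unique (tendsto_pure_nhds f t) this).symm
  rwa [this] at hl

end Cadlag

/-! ### Convolution with a probability distribution on the half-line -/

section Convol

theorem convol_eq_integral_indicator (g : ℝ≥0 → ℝ) (F : Measure ℝ≥0) (t : ℝ≥0) :
    convol g F t = ∫ s, (Set.Iic t).indicator (fun s => g (t - s)) s ∂F :=
  (integral_indicator measurableSet_Iic).symm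

theorem convol_const {F : Measure ℝ≥0} (c : ℝ) (t : ℝ≥0) :
    convol (fun _ => c) F t = c * distFun F t := by
  simp [convol, distFun, mul_comm]

theorem distFun_nonneg {F : Measure ℝ≥0} (t : ℝ≥0) : 0 ≤ distFun F t := measureReal_nonneg

theorem convol_div_const {F : Measure ℝ≥0} (f : ℝ≥0 → ℝ) (c : ℝ) (t : ℝ≥0) :
    convol (fun u => f u / c) F t = convol f F t / c :=
  integral_div _ _

variable {F : Measure ℝ≥0} [IsProbabilityMeasure F]

theorem IsCadlag.integrableOn_convol {f : ℝ≥0 → ℝ} (hf : IsCadlag f) (t : ℝ≥0) :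
    IntegrableOn (fun s => f (t - s)) (Set.Iic t) F := by
  obtain ⟨M, -, hM⟩ := hf.exists_bound t
  refine Measure.integrableOn_of_bounded (M := M) (measure_ne_top _ _)
    (hf.measurable.comp (by fun_prop)).aestronglyMeasurable ?_
  exact .of_forall fun s => hM _ tsub_le_self

/-- Dominated convergence along a one-sided neighbourhood filter, the integrands being extended by
zero to a common domain and bounded by local boundedness of `f`. -/
theorem IsCadlag.convol {f : ℝ≥0 → ℝ} (hf : IsCadlag f) : IsCadlag (convol f F) := by
  have main : ∀ (t : ℝ≥0) (l : Filter ℝ≥0) [l.IsCountablyGenerated] (G : ℝ≥0 → ℝ), l ≤ 𝓝 t →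
      (∀ s, Tendsto (fun u => (Set.Iic u).indicator (fun s => f (u - s)) s) l (𝓝 (G s))) →
      Tendsto (ManyServerQueue.convol f F) l (𝓝 (∫ s, G s ∂F)) := by
    intro t l _ G hl hG
    obtain ⟨M, hM0, hM⟩ := hf.exists_bound (t + 1)
    have hb : ∀ᶠ u in l, u ≤ t + 1 := hl (Iic_mem_nhds (by simp))
    simp only [funext (convol_eq_integral_indicator f F)]
    refine tendsto_integral_filter_of_dominated_convergence (fun _ => M) ?_ ?_
      (integrable_const _) (.of_forall hG)
    · exact .of_forall fun u =>
        ((hf.measurable.comp (by fun_prop)).indicator measurableSet_Iic).aestronglyMeasurable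
    · filter_upwards [hb] with u hu
      refine .of_forall fun s => ?_
      by_cases hs : s ∈ Set.Iic u
      · rw [Set.indicator_of_mem hs]
        exact hM _ (tsub_le_self.trans hu)
      · rw [Set.indicator_of_notMem hs]
        simpa using hM0
  intro t
  constructor
  · have := main t (𝓝[≥] t) ((Set.Iic t).indicator fun s => f (t - s)) nhdsWithin_le_nhds ?_
    · rwa [← convol_eq_integral_indicator] at this
    intro s
    rcases le_or_gt s t with hs | hs
    · rw [Set.indicator_of_mem (Set.mem_Iic.2 hs)]
      have h1 : Tendsto (fun u => u - s) (𝓝[≥] t) (𝓝[≥] (t - s)) := by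
        refine tendsto_nhdsWithin_iff.2 ⟨?_, ?_⟩
        · exact ((continuous_id.sub continuous_const).tendsto t).mono_left nhdsWithin_le_nhds
        · filter_upwards [self_mem_nhdsWithin] with u hu using tsub_le_tsub_right hu s
      refine ((hf (t - s)).1.tendsto.comp h1).congr' ?_
      filter_upwards [self_mem_nhdsWithin] with u hu
      rw [Set.indicator_of_mem (Set.mem_Iic.2 (hs.trans hu))]
      rfl
    · rw [Set.indicator_of_notMem (by simpa using hs)]
      refine tendsto_const_nhds.congr' ?_
      filter_upwards [mem_nhdsWithin_of_mem_nhds (Iio_mem_nhds hs)] with u hu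
      rw [Set.indicator_of_notMem (by simpa using hu)]
  · choose l hl using fun u => (hf u).2
    -- The pointwise limit vanishes at `s = t`, because `u < t` excludes `s` from `Iic u`; hence
    -- `Iio` in place of `Iic`.
    refine ⟨_, main t (𝓝[<] t) ((Set.Iio t).indicator fun s => l (t - s)) nhdsWithin_le_nhds ?_⟩
    intro s
    rcases lt_or_ge s t with hs | hs
    · rw [Set.indicator_of_mem (Set.mem_Iio.2 hs)]
      have hmem : ∀ᶠ u in 𝓝[<] t, s < u := mem_nhdsWithin_of_mem_nhds (Ioi_mem_nhds hs)
      have h1 : Tendsto (fun u => u - s) (𝓝[<] t) (𝓝[<] (t - s)) := by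
        refine tendsto_nhdsWithin_iff.2 ⟨?_, ?_⟩
        · exact ((continuous_id.sub continuous_const).tendsto t).mono_left nhdsWithin_le_nhds
        · filter_upwards [self_mem_nhdsWithin, hmem] with u hu hsu
          exact tsub_lt_tsub_right_of_le hsu.le hu
      refine ((hl (t - s)).comp h1).congr' ?_
      filter_upwards [hmem] with u hu
      rw [Set.indicator_of_mem (Set.mem_Iic.2 hu.le)]
      rfl
    · rw [Set.indicator_of_notMem (by simpa using hs)]
      refine tendsto_const_nhds.congr' ?_
      filter_upwards [self_mem_nhdsWithin] with u hu
      rw [Set.indicator_of_notMem (by simpa using lt_of_lt_of_le hu hs)]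

theorem isCadlag_distFun : IsCadlag (distFun F) := by
  have := (isCadlag_const (1 : ℝ)).convol (F := F)
  simpa only [funext (convol_const (F := F) 1), one_mul] using this

theorem distFun_le_one (t : ℝ≥0) : distFun F t ≤ 1 := measureReal_le_one

theorem convol_add {f g : ℝ≥0 → ℝ} (hf : IsCadlag f) (hg : IsCadlag g) (t : ℝ≥0) :
    convol (fun u => f u + g u) F t = convol f F t + convol g F t :=
  integral_add (hf.integrableOn_convol t) (hg.integrableOn_convol t)

theorem convol_sub {f g : ℝ≥0 → ℝ} (hf : IsCadlag f) (hg : IsCadlag g) (t : ℝ≥0) :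
    convol (fun u => f u - g u) F t = convol f F t - convol g F t :=
  integral_sub (hf.integrableOn_convol t) (hg.integrableOn_convol t)

theorem abs_convol_le {f : ℝ≥0 → ℝ} {T : ℝ≥0} {M : ℝ} (hM : 0 ≤ M) (h : ∀ t ≤ T, |f t| ≤ M)
    {t : ℝ≥0} (ht : t ≤ T) : |convol f F t| ≤ M := by
  have := norm_setIntegral_le_of_norm_le_const (μ := F) (s := Set.Iic t)
    (f := fun s => f (t - s)) (C := M) (measure_lt_top _ _)
    (fun s _ => h _ (tsub_le_self.trans ht))
  refine this.trans (mul_le_of_le_one_right hM measureReal_le_one)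

theorem abs_convol_sub_le {f g : ℝ≥0 → ℝ} (hf : IsCadlag f) (hg : IsCadlag g) {T : ℝ≥0} {M : ℝ}
    (h : ∀ t ≤ T, |f t - g t| ≤ M) {t : ℝ≥0} (ht : t ≤ T) :
    |convol f F t - convol g F t| ≤ M := by
  rw [← convol_sub hf hg]
  exact abs_convol_le ((abs_nonneg _).trans (h t ht)) h ht

end Convol

/-! ### The Volterra equation `x = z + (x - 1)⁺ * F` -/

section Volterra

/-- The Laplace transform at `1` of a distribution on `[0, ∞)`. -/
noncomputable def laplaceOne (F : Measure ℝ≥0) : ℝ := ∫ s : ℝ≥0, Real.exp (-s) ∂F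

theorem laplaceOne_nonneg {F : Measure ℝ≥0} : 0 ≤ laplaceOne F := integral_nonneg fun _ => (Real.exp_pos _).le

variable {F : Measure ℝ≥0} [IsProbabilityMeasure F]

theorem integrable_exp_neg : Integrable (fun s : ℝ≥0 => Real.exp (-s)) F := by
  refine Integrable.of_bound (C := 1) (by fun_prop) (.of_forall fun s => ?_)
  rw [Real.norm_eq_abs, abs_of_pos (Real.exp_pos _)]
  exact Real.exp_le_one_iff.2 (neg_nonpos.2 s.2)

theorem laplaceOne_lt_one (hF : F (Set.Iic 0) < 1) : laplaceOne F < 1 := by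
  have h : 0 < ∫ s : ℝ≥0, (1 - Real.exp (-s)) ∂F := by
    rw [integral_pos_iff_support_of_nonneg]
    · have : Function.support (fun s : ℝ≥0 => 1 - Real.exp (-s)) = (Set.Iic 0)ᶜ := by
        ext s
        simp [sub_eq_zero, eq_comm (a := (1 : ℝ)), pos_iff_ne_zero]
      rw [this, prob_compl_eq_one_sub measurableSet_Iic]
      exact tsub_pos_of_lt hF
    · intro s
      simp
    · exact (integrable_const _).sub integrable_exp_neg
  rw [integral_sub (integrable_const _) integrable_exp_neg] at h
  simpa [laplaceOne] using h

/-- The weight factorizes, `e^{t-s} = e^t e^{-s}`, so convolution with `F` contracts the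
exponentially weighted sup norm by the factor `laplaceOne F`. -/
theorem abs_convol_le_exp {h : ℝ≥0 → ℝ} {T : ℝ≥0} {M : ℝ} (hM : 0 ≤ M)
    (hh : ∀ u ≤ T, |h u| ≤ M * Real.exp u) {t : ℝ≥0} (ht : t ≤ T) :
    |convol h F t| ≤ M * laplaceOne F * Real.exp t := by
  have hint : Integrable (fun s : ℝ≥0 => M * Real.exp t * Real.exp (-s)) F :=
    integrable_exp_neg.const_mul _
  calc |convol h F t| ≤ ∫ s in Set.Iic t, M * Real.exp t * Real.exp (-s) ∂F := by
        refine norm_integral_le_of_norm_le (f := fun s => h (t - s)) hint.integrableOn ?_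
        refine (ae_restrict_iff' measurableSet_Iic).2 (.of_forall fun s hs => ?_)
        refine (hh _ (tsub_le_self.trans ht)).trans_eq ?_
        rw [NNReal.coe_sub hs, sub_eq_add_neg, Real.exp_add, mul_assoc]
    _ ≤ ∫ s, M * Real.exp t * Real.exp (-s) ∂F :=
        setIntegral_le_integral hint (.of_forall fun s => by positivity)
    _ = M * laplaceOne F * Real.exp t := by
        rw [integral_const_mul, laplaceOne]; ring

theorem abs_posPart_sub_one_sub_le (x y : ℝ) : |max (x - 1) 0 - max (y - 1) 0| ≤ |x - y| := by
  simpa using abs_max_sub_max_le_abs (x - 1) (y - 1) 0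

/-- Solutions of `x = z + (x - 1)⁺ * F` depend Lipschitz continuously on `z`. -/
theorem volterra_stability (hF : F (Set.Iic 0) < 1) {x x' : ℝ≥0 → ℝ} (hx : IsCadlag x)
    (hx' : IsCadlag x') {T : ℝ≥0} {ζ : ℝ}
    (h : ∀ t ≤ T, |(x t - convol (fun u => max (x u - 1) 0) F t)
      - (x' t - convol (fun u => max (x' u - 1) 0) F t)| ≤ ζ) {t : ℝ≥0} (ht : t ≤ T) :
    |x t - x' t| ≤ Real.exp T / (1 - laplaceOne F) * ζ := by
  have hζ : 0 ≤ ζ := (abs_nonneg _).trans (h t ht)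
  have hρ := laplaceOne_lt_one hF
  obtain ⟨M, hM0, hM⟩ := (hx.sub hx').exists_bound T
  -- `sSup S` is the weighted norm of `x - x'` on `[0, T]`. It is finite, so `sSup S ≤ ζ + ρ * sSup
  -- S` with `ρ = laplaceOne F < 1` can be solved for it; removing the weight costs the factor
  -- `e^T`.
  let S : Set ℝ := (fun u : ℝ≥0 => Real.exp (-u) * |x u - x' u|) '' Set.Iic T
  have hbdd : BddAbove S := by
    refine ⟨M, ?_⟩
    rintro _ ⟨u, hu, rfl⟩
    refine (mul_le_of_le_one_left (abs_nonneg _) ?_).trans (hM u hu)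
    exact Real.exp_le_one_iff.2 (neg_nonpos.2 u.2)
  have hle : ∀ u ≤ T, |x u - x' u| ≤ sSup S * Real.exp u := fun u hu => by
    have := le_csSup hbdd (Set.mem_image_of_mem _ hu)
    rw [← mul_inv_le_iff₀ (Real.exp_pos _), ← Real.exp_neg, mul_comm]
    exact this
  have hS0 : 0 ≤ sSup S := by
    have := (abs_nonneg _).trans (hle t ht)
    exact nonneg_of_mul_nonneg_left this (Real.exp_pos _)
  have hS : sSup S ≤ ζ + sSup S * laplaceOne F := by
    refine csSup_le ⟨_, Set.mem_image_of_mem _ (Set.mem_Iic.2 ht)⟩ ?_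
    rintro _ ⟨u, hu, rfl⟩
    have h1 := h u hu
    have h2 := abs_convol_le_exp (F := F) (h := fun u => max (x u - 1) 0 - max (x' u - 1) 0)
      hS0 (fun v hv => (abs_posPart_sub_one_sub_le _ _).trans (hle v hv)) hu
    rw [convol_sub hx.posPart_sub_one hx'.posPart_sub_one] at h2
    have h3 : |x u - x' u| ≤ ζ * Real.exp u + sSup S * laplaceOne F * Real.exp u := by
      have : ζ ≤ ζ * Real.exp u := le_mul_of_one_le_right hζ (Real.one_le_exp u.2)
      rw [abs_le] at *
      constructor <;> linarith
    change Real.exp (-u) * |x u - x' u| ≤ _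
    rw [mul_comm, Real.exp_neg, mul_inv_le_iff₀ (Real.exp_pos _)]
    linarith
  have h4 : sSup S ≤ ζ / (1 - laplaceOne F) := by
    rw [le_div_iff₀ (by linarith)]
    linarith
  calc |x t - x' t| ≤ sSup S * Real.exp t := hle t ht
    _ ≤ ζ / (1 - laplaceOne F) * Real.exp T := by
        have : Real.exp t ≤ Real.exp T := Real.exp_le_exp.2 ht
        gcongr
    _ = _ := by ring

theorem volterra_unique (hF : F (Set.Iic 0) < 1) {x x' z : ℝ≥0 → ℝ} (hx : IsCadlag x)
    (hx' : IsCadlag x') (h : ∀ t, x t = z t + convol (fun u => max (x u - 1) 0) F t)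
    (h' : ∀ t, x' t = z t + convol (fun u => max (x' u - 1) 0) F t) : x = x' := by
  funext t
  have := volterra_stability hF hx hx' (T := t) (ζ := 0) (fun u _ => by
    rw [abs_nonpos_iff, h u, h' u]; ring) le_rfl
  rw [mul_zero, abs_nonpos_iff] at this
  exact sub_eq_zero.1 this

/-- Picard iterates for the equation `x = z + (x - 1)⁺ * F`. -/
noncomputable def picard (z : ℝ≥0 → ℝ) (F : Measure ℝ≥0) : ℕ → ℝ≥0 → ℝ
  | 0 => z
  | k + 1 => fun t => z t + convol (fun u => max (picard z F k u - 1) 0) F t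

theorem isCadlag_picard {z : ℝ≥0 → ℝ} (hz : IsCadlag z) (k : ℕ) : IsCadlag (picard z F k) := by
  induction k with
  | zero => exact hz
  | succ k ih => exact hz.add ih.posPart_sub_one.convol

/-- Successive Picard differences decay geometrically, uniformly on each `[0, T]`. The limit is
therefore locally uniform, hence càdlàg, and passes through the convolution. -/
theorem volterra_exists (hF : F (Set.Iic 0) < 1) {z : ℝ≥0 → ℝ} (hz : IsCadlag z) :
    ∃ x, IsCadlag x ∧ ∀ t, x t = z t + convol (fun u => max (x u - 1) 0) F t := by
  have hρ := laplaceOne_lt_one hF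
  have hρ0 := laplaceOne_nonneg (F := F)
  have hp := isCadlag_picard (F := F) hz
  have hgeom : ∀ T : ℝ≥0, ∃ M, 0 ≤ M ∧ ∀ k, ∀ t ≤ T,
      dist (picard z F k t) (picard z F (k + 1) t) ≤ M * laplaceOne F ^ k := by
    intro T
    obtain ⟨M, hM0, hM⟩ := ((hp 1).sub (hp 0)).exists_bound T
    have key : ∀ k, ∀ t ≤ T, |picard z F (k + 1) t - picard z F k t|
        ≤ M * laplaceOne F ^ k * Real.exp t := by
      intro k
      induction k with
      | zero =>
        intro t ht
        refine (hM t ht).trans ?_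
        rw [pow_zero, mul_one]
        exact le_mul_of_one_le_right hM0 (Real.one_le_exp t.2)
      | succ k ih =>
        intro t ht
        have := abs_convol_le_exp (F := F) (by positivity)
          (fun u hu => (abs_posPart_sub_one_sub_le _ _).trans (ih u hu)) ht
        rw [convol_sub (hp _).posPart_sub_one (hp _).posPart_sub_one] at this
        rw [pow_succ, ← mul_assoc]
        refine le_trans (le_of_eq ?_) this
        rw [picard, picard, add_sub_add_left_eq_sub]
    refine ⟨M * Real.exp T, by positivity, fun k t ht => ?_⟩
    rw [dist_comm, Real.dist_eq]
    refine (key k t ht).trans ?_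
    have : Real.exp t ≤ Real.exp T := Real.exp_le_exp.2 ht
    calc _ ≤ M * laplaceOne F ^ k * Real.exp T := by gcongr
      _ = _ := by ring
  have hlim : ∀ t, ∃ l, Tendsto (fun k => picard z F k t) atTop (𝓝 l) := fun t => by
    obtain ⟨M, -, hM⟩ := hgeom t
    exact cauchySeq_tendsto_of_complete
      (cauchySeq_of_le_geometric _ M hρ fun k => hM k t le_rfl)
  choose x hx using hlim
  have hunif : ∀ T : ℝ≥0, ∀ ε > 0, ∃ N, ∀ k ≥ N, ∀ t ≤ T, |x t - picard z F k t| < ε := by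
    intro T ε hε
    obtain ⟨M, hM0, hM⟩ := hgeom T
    have h0 : Tendsto (fun k : ℕ => M * laplaceOne F ^ k / (1 - laplaceOne F)) atTop (𝓝 0) := by
      have := ((tendsto_pow_atTop_nhds_zero_of_lt_one hρ0 hρ).const_mul M).div_const
        (1 - laplaceOne F)
      simpa using this
    obtain ⟨N, hN⟩ := eventually_atTop.1 (h0.eventually_lt_const hε)
    refine ⟨N, fun k hk t ht => ?_⟩
    rw [← Real.dist_eq, dist_comm]
    exact (dist_le_of_le_geometric_of_tendsto _ M hρ (fun k => hM k t ht) (hx t) k).trans_lt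
      (hN k hk)
  have hxc : IsCadlag x := isCadlag_of_locally_uniform_approx fun T ε hε => by
    obtain ⟨N, hN⟩ := hunif T ε hε
    exact ⟨_, hp N, hN N le_rfl⟩
  refine ⟨x, hxc, fun t => ?_⟩
  refine tendsto_nhds_unique ((tendsto_add_atTop_iff_nat 1).2 (hx t)) ?_
  refine tendsto_const_nhds.add (Metric.tendsto_atTop.2 fun ε hε => ?_)
  obtain ⟨N, hN⟩ := hunif t (ε / 2) (by positivity)
  refine ⟨N, fun k hk => ?_⟩
  rw [dist_comm, Real.dist_eq]
  refine (abs_convol_sub_le hxc.posPart_sub_one (hp k).posPart_sub_one (M := ε / 2)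
    (fun u hu => (abs_posPart_sub_one_sub_le _ _).trans (hN k hk u hu).le) le_rfl).trans_lt
    (by linarith)

end Volterra

end ManyServerQueue

namespace ManyServerQueue

/-! ### Events of probability tending to one -/

section WithHighProb

variable {Ω : Type*} [MeasurableSpace Ω] {P : Measure Ω}

/-- The property `p n` holds with probability tending to `1`; the failure events need not be
measurable. -/
def WithHighProb (P : Measure Ω) (p : ℕ → Ω → Prop) : Prop :=
  Tendsto (fun n => P {ω | ¬ p n ω}) atTop (𝓝 0)

theorem WithHighProb.mono {p q : ℕ → Ω → Prop} (hp : WithHighProb P p)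
    (h : ∀ᶠ n in atTop, ∀ᵐ ω ∂P, p n ω → q n ω) : WithHighProb P q := by
  refine tendsto_of_tendsto_of_tendsto_of_le_of_le' tendsto_const_nhds hp
    (.of_forall fun _ => zero_le) ?_
  filter_upwards [h] with n hn
  refine measure_mono_ae ?_
  filter_upwards [hn] with ω hω
  exact mt hω

theorem WithHighProb.and {p q : ℕ → Ω → Prop} (hp : WithHighProb P p) (hq : WithHighProb P q) :
    WithHighProb P fun n ω => p n ω ∧ q n ω := by
  have := Tendsto.add hp hq
  rw [add_zero] at this
  refine tendsto_of_tendsto_of_tendsto_of_le_of_le tendsto_const_nhds this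
    (fun _ => zero_le) fun n => ?_
  refine (measure_mono fun ω hω => ?_).trans (measure_union_le _ _)
  exact not_and_or.1 hω

theorem withHighProb_true : WithHighProb P fun _ _ => True := by
  simp [WithHighProb]

theorem WithHighProb.finset_forall {ι : Type*} (s : Finset ι) {p : ι → ℕ → Ω → Prop}
    (hp : ∀ i, WithHighProb P (p i)) : WithHighProb P fun n ω => ∀ i ∈ s, p i n ω := by
  classical
  induction s using Finset.induction_on with
  | empty => simpa using withHighProb_true
  | insert a s _ ih =>
    refine ((hp a).and ih).mono (.of_forall fun n => .of_forall fun ω h => ?_)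
    simpa using h

/-- Almost sure convergence implies convergence in probability. Measurability enters only here;
events quantified over uncountably many sets or paths are reached afterwards by `WithHighProb.mono`.
-/
theorem withHighProb_of_ae_eventually [IsFiniteMeasure P] {p : ℕ → Ω → Prop}
    (hm : ∀ n, MeasurableSet {ω | p n ω}) (h : ∀ᵐ ω ∂P, ∀ᶠ n in atTop, p n ω) :
    WithHighProb P p := by
  have := tendsto_measure_of_ae_tendsto_indicator_of_isFiniteMeasure (μ := P) atTop
    (As := fun n => {ω | ¬ p n ω}) (A := ∅) MeasurableSet.empty
    (fun n => (hm n).compl) (by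
      filter_upwards [h] with ω hω
      filter_upwards [hω] with n hn
      simpa using hn)
  rw [measure_empty] at this
  exact this

theorem tendstoUCP_iff {X : ℕ → Ω → ℝ≥0 → ℝ} {x : ℝ≥0 → ℝ} :
    TendstoUCP P X x ↔ ∀ T : ℝ≥0, 0 < T → ∀ ε : ℝ, 0 < ε →
      WithHighProb P fun n ω => ∀ t ≤ T, |X n ω t - x t| ≤ ε := by
  have key : ∀ (T ε : ℝ≥0) n, {ω | (ε : ℝ≥0∞) < ⨆ t ∈ Set.Iic T, ‖X n ω t - x t‖ₑ}
      = {ω | ¬ ∀ t ≤ T, |X n ω t - x t| ≤ ε} := by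
    intro T ε n
    ext ω
    simp only [Set.mem_ofPred_eq, lt_iSup_iff, not_forall, not_le, Set.mem_Iic]
    refine exists_congr fun t => exists_congr fun _ => ?_
    rw [enorm_eq_nnnorm, ENNReal.coe_lt_coe, ← NNReal.coe_lt_coe, coe_nnnorm, Real.norm_eq_abs]
  constructor
  · intro h T hT ε hε
    lift ε to ℝ≥0 using hε.le
    exact (h T hT ε (NNReal.coe_pos.1 hε)).congr fun n => congrArg P (key T ε n)
  · intro h T hT ε hε
    exact (h T hT ε (NNReal.coe_pos.2 hε)).congr fun n => congrArg P (key T ε n).symm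

theorem withHighProb_of_tendstoInMeasure {X : ℕ → Ω → ℝ} {c : ℝ}
    (h : TendstoInMeasure P X atTop fun _ => c) {ε : ℝ} (hε : 0 < ε) :
    WithHighProb P fun n ω => |X n ω - c| ≤ ε := by
  have := tendstoInMeasure_iff_norm.1 h ε hε
  refine tendsto_of_tendsto_of_tendsto_of_le_of_le tendsto_const_nhds this
    (fun _ => zero_le) fun n => measure_mono fun ω hω => ?_
  exact (not_le.1 hω).le

end WithHighProb

/-! ### Law of large numbers uniform over lower sets and initial segments -/

section GlivenkoCantelli

/-- The number of `i < k` with `η i ∈ C`. -/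
noncomputable def count (η : ℕ → ℝ≥0) (k : ℕ) (C : Set ℝ≥0) : ℝ :=
  ∑ i ∈ Finset.range k, C.indicator (fun _ => (1 : ℝ)) (η i)

theorem count_mono (η : ℕ → ℝ≥0) (k : ℕ) {C D : Set ℝ≥0} (h : C ⊆ D) :
    count η k C ≤ count η k D :=
  Finset.sum_le_sum fun _ _ => Set.indicator_le_indicator_of_subset h (fun _ => zero_le_one) _

/-- Beyond some `N` the error is at most `k * δ / (J + 1)`, which is below `δ * n` for `k ≤ J * n`;
the finitely many smaller `k` contribute a constant, eventually below `δ * n`. -/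
theorem eventually_forall_le_abs_sub_le {u : ℕ → ℝ} {c : ℝ}
    (h : Tendsto (fun k => u k / k) atTop (𝓝 c)) (J : ℕ) {δ : ℝ} (hδ : 0 < δ) :
    ∀ᶠ n : ℕ in atTop, ∀ k ≤ J * n, |u k - k * c| ≤ δ * n := by
  obtain ⟨N, hN⟩ := Metric.tendsto_atTop.1 h (δ / (J + 1)) (by positivity)
  obtain ⟨n₀, hn₀⟩ := exists_nat_gt ((∑ k ∈ Finset.range (N + 1), |u k - k * c|) / δ)
  filter_upwards [eventually_ge_atTop n₀] with n hn k hk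
  have hn' : (n₀ : ℝ) ≤ n := by exact_mod_cast hn
  rcases lt_or_ge k (N + 1) with hkN | hkN
  · have h1 := Finset.single_le_sum (f := fun k : ℕ => |u k - k * c|)
      (fun _ _ => abs_nonneg _) (Finset.mem_range.2 hkN)
    rw [div_lt_iff₀ hδ] at hn₀
    have : (n₀ : ℝ) * δ ≤ n * δ := by gcongr
    linarith
  · have hk0 : (0 : ℝ) < k := by
      have : 0 < k := by omega
      exact_mod_cast this
    have h1 := hN k (by omega)
    rw [Real.dist_eq] at h1
    have h2 : u k - k * c = k * (u k / k - c) := by field_simp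
    have hkJ : (k : ℝ) ≤ J * n := by exact_mod_cast hk
    rw [h2, abs_mul, abs_of_pos hk0]
    calc k * |u k / k - c| ≤ (J * n) * (δ / (J + 1)) := by gcongr
      _ = δ * n * (J / (J + 1)) := by ring
      _ ≤ δ * n := by
        refine mul_le_of_le_one_right (by positivity) ?_
        rw [div_le_one (by positivity)]
        linarith

/-- A lower set need not have a greatest element, but its compact subsets do, and inner regularity
reduces to them. -/
theorem IsLowerSet.measureReal_le {F : Measure ℝ≥0} [IsProbabilityMeasure F] {G : Set ℝ≥0}
    (hG : IsLowerSet G) {c : ℝ} (hc : 0 ≤ c) (h : ∀ y ∈ G, F.real (Set.Iic y) ≤ c) :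
    F.real G ≤ c := by
  refine ENNReal.toReal_le_of_le_ofReal hc ?_
  rw [hG.ordConnected.measurableSet.measure_eq_iSup_isCompact]
  refine iSup₂_le fun K hKG => iSup_le fun hK => ?_
  rcases K.eq_empty_or_nonempty with rfl | hne
  · simp
  obtain ⟨y, hy, hmax⟩ := hK.exists_isGreatest hne
  refine (measure_mono fun x hx => hmax hx).trans ?_
  exact (ENNReal.le_ofReal_iff_toReal_le (measure_ne_top _ _) hc).2 (h y (hKG hy))

theorem IsUpperSet.measureReal_le {F : Measure ℝ≥0} [IsProbabilityMeasure F] {G : Set ℝ≥0}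
    (hG : IsUpperSet G) {c : ℝ} (hc : 0 ≤ c) (h : ∀ y ∈ G, F.real (Set.Ici y) ≤ c) :
    F.real G ≤ c := by
  refine ENNReal.toReal_le_of_le_ofReal hc ?_
  rw [hG.ordConnected.measurableSet.measure_eq_iSup_isCompact]
  refine iSup₂_le fun K hKG => iSup_le fun hK => ?_
  rcases K.eq_empty_or_nonempty with rfl | hne
  · simp
  obtain ⟨y, hy, hmin⟩ := hK.exists_isLeast hne
  refine (measure_mono fun x hx => hmin hx).trans ?_
  exact (ENNReal.le_ofReal_iff_toReal_le (measure_ne_top _ _) hc).2 (h y (hKG hy))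

/-- Finitely many lower sets bracket all lower sets up to mass `1 / m`. -/
theorem exists_bracketing (F : Measure ℝ≥0) [IsProbabilityMeasure F] {m : ℕ} (hm : 0 < m) :
    ∃ G H : ℕ → Set ℝ≥0, (∀ j, MeasurableSet (G j)) ∧ (∀ j, MeasurableSet (H j)) ∧
      ∀ C : Set ℝ≥0, IsLowerSet C → ∃ j ≤ m, H j ⊆ C ∧ C ⊆ G j ∧
        F.real (G j) ≤ F.real C + 1 / m ∧ F.real C - 1 / m ≤ F.real (H j) := by
  have hm' : (0 : ℝ) < m := by exact_mod_cast hm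
  -- Quantile sets, with `Iic` for the outer and `Iio` for the inner bracket, so that atoms of `F`
  -- do no harm.
  let G : ℕ → Set ℝ≥0 := fun j => {y | F.real (Set.Iic y) < (j + 1) / m}
  let H : ℕ → Set ℝ≥0 := fun j => {y | F.real (Set.Iio y) < j / m}
  have hG : ∀ j, IsLowerSet (G j) := fun j a b hba ha =>
    (measureReal_mono (Set.Iic_subset_Iic.2 hba)).trans_lt ha
  have hH : ∀ j, IsLowerSet (H j) := fun j a b hba ha =>
    (measureReal_mono (Set.Iio_subset_Iio hba)).trans_lt ha
  refine ⟨G, H, fun j => (hG j).ordConnected.measurableSet,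
    fun j => (hH j).ordConnected.measurableSet, fun C hC => ?_⟩
  have hFC : F.real C ≤ 1 := measureReal_le_one
  have hFC0 : 0 ≤ F.real C := measureReal_nonneg
  -- The level with `j / m ≤ F(C) < (j + 1) / m`.
  let j := ⌊F.real C * m⌋₊
  have hj1 : (j : ℝ) ≤ F.real C * m := Nat.floor_le (by positivity)
  have hj2 : F.real C * m < j + 1 := Nat.lt_floor_add_one _
  have hjm : j ≤ m := by
    have : (j : ℝ) ≤ m := hj1.trans (mul_le_of_le_one_left hm'.le hFC)
    exact_mod_cast this
  have hj1' : (j : ℝ) / m ≤ F.real C := by rwa [div_le_iff₀ hm']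
  have hj2' : F.real C < (j + 1) / m := by rwa [lt_div_iff₀ hm']
  have hadd : ((j : ℝ) + 1) / m = j / m + 1 / m := add_div _ _ _
  refine ⟨j, hjm, fun y hy => ?_, fun y hy => ?_, ?_, ?_⟩
  · by_contra hyC
    have : C ⊆ Set.Iio y := fun x hx => not_le.1 fun hyx => hyC (hC hyx hx)
    have h1 : F.real C ≤ F.real (Set.Iio y) := measureReal_mono this
    have h2 : F.real (Set.Iio y) < j / m := hy
    linarith
  · have : Set.Iic y ⊆ C := fun x hx => hC hx hy
    exact (measureReal_mono this).trans_lt hj2'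
  · have := IsLowerSet.measureReal_le (F := F) (hG j) (c := (j + 1) / m) (by positivity)
      fun y hy => le_of_lt hy
    linarith
  · have hj1m : (j : ℝ) / m ≤ 1 := hj1'.trans hFC
    have := IsUpperSet.measureReal_le (F := F) (hH j).compl (c := 1 - j / m) (by linarith)
      fun y hy => by
        have h1 : (j : ℝ) / m ≤ F.real (Set.Iio y) := not_lt.1 hy
        have h2 : F.real (Set.Ici y) = 1 - F.real (Set.Iio y) := by
          rw [← Set.compl_Iio, probReal_compl_eq_one_sub measurableSet_Iio]
        linarith
    rw [probReal_compl_eq_one_sub (hH j).ordConnected.measurableSet] at this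
    linarith

variable {Ω : Type*} [MeasurableSpace Ω] {P : Measure Ω} [IsProbabilityMeasure P]

theorem ae_tendsto_count_div {F : Measure ℝ≥0} {η : ℕ → Ω → ℝ≥0} (hη : ∀ i, Measurable (η i))
    (hind : iIndepFun η P) (hlaw : ∀ i, P.map (η i) = F) {B : Set ℝ≥0} (hB : MeasurableSet B) :
    ∀ᵐ ω ∂P, Tendsto (fun k : ℕ => count (fun i => η i ω) k B / k) atTop (𝓝 (F.real B)) := by
  have hφ : Measurable (B.indicator fun _ => (1 : ℝ)) := measurable_const.indicator hB
  have hint : Integrable ((B.indicator fun _ => (1 : ℝ)) ∘ η 0) P := by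
    refine Integrable.of_bound (C := 1) (hφ.comp (hη 0)).aestronglyMeasurable
      (.of_forall fun ω => ?_)
    by_cases h : η 0 ω ∈ B <;> simp [h]
  have := strong_law_ae_real (fun i => (B.indicator fun _ => (1 : ℝ)) ∘ η i) hint
    (fun i j hij => (hind.indepFun hij).comp hφ hφ)
    (fun i => (IdentDistrib.mk (hη i).aemeasurable (hη 0).aemeasurable
      ((hlaw i).trans (hlaw 0).symm)).comp hφ)
  have hmean : P[(B.indicator fun _ => (1 : ℝ)) ∘ η 0] = F.real B := by
    rw [← hlaw 0, ← integral_indicator_one hB]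
    exact (integral_map (hη 0).aemeasurable hφ.aestronglyMeasurable).symm
  rw [hmean] at this
  exact this

/-- A law of large numbers, uniform over initial segments of the sequence and over lower sets. -/
theorem withHighProb_count {F : Measure ℝ≥0} [IsProbabilityMeasure F] {η : ℕ → Ω → ℝ≥0}
    (hη : ∀ i, Measurable (η i)) (hind : iIndepFun η P) (hlaw : ∀ i, P.map (η i) = F) (J : ℕ)
    {δ : ℝ} (hδ : 0 < δ) :
    WithHighProb P fun n ω => ∀ k ≤ J * n, ∀ C : Set ℝ≥0, IsLowerSet C →
      |count (fun i => η i ω) k C - k * F.real C| ≤ δ * n := by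
  have single : ∀ B : Set ℝ≥0, MeasurableSet B → WithHighProb P fun n ω => ∀ k ≤ J * n,
      |count (fun i => η i ω) k B - k * F.real B| ≤ δ / 2 * n := by
    intro B hB
    have hmeas : ∀ k, Measurable fun ω => count (fun i => η i ω) k B := fun k =>
      Finset.measurable_sum _ fun i _ =>
        (measurable_const.indicator hB : Measurable (B.indicator fun _ => (1 : ℝ))).comp (hη i)
    refine withHighProb_of_ae_eventually (fun n => ?_) ?_
    · simp only [Set.ofPred_forall]
      refine MeasurableSet.iInter fun k => MeasurableSet.iInter fun _ => ?_
      exact measurableSet_le ((hmeas k).sub_const _).abs measurable_const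
    · filter_upwards [ae_tendsto_count_div hη hind hlaw hB] with ω hω
      exact eventually_forall_le_abs_sub_le hω J (by positivity)
  -- Makes the bracketing error `k / m ≤ J * n / m` at most `δ / 2 * n`; the other half is the
  -- sampling error for the finitely many brackets.
  obtain ⟨m, hm⟩ := exists_nat_gt (2 * J / δ)
  have hm0 : 0 < m := by
    have : (0 : ℝ) < m := lt_of_le_of_lt (by positivity) hm
    exact_mod_cast this
  obtain ⟨G, H, hG, hH, hb⟩ := exists_bracketing F hm0
  refine (WithHighProb.finset_forall (Finset.range (m + 1))
    fun j => (single (G j) (hG j)).and (single (H j) (hH j))).mono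
    (.of_forall fun n => .of_forall fun ω h k hk C hC => ?_)
  obtain ⟨j, hj, hHC, hCG, hFG, hFH⟩ := hb C hC
  obtain ⟨h1, h2⟩ := h j (Finset.mem_range.2 (by omega))
  have h1 := abs_le.1 (h1 k hk)
  have h2 := abs_le.1 (h2 k hk)
  have h3 := count_mono (fun i => η i ω) k hHC
  have h4 := count_mono (fun i => η i ω) k hCG
  have hk' : (k : ℝ) ≤ J * n := by exact_mod_cast hk
  have hm' : (0 : ℝ) < m := by exact_mod_cast hm0
  have h5 : (k : ℝ) * (1 / m) ≤ δ / 2 * n := by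
    rw [div_lt_iff₀ hδ] at hm
    rw [mul_one_div, div_le_iff₀ hm']
    have : (n : ℝ) * (2 * J) ≤ n * (m * δ) := by gcongr
    linarith
  have h6 : (k : ℝ) * F.real (G j) ≤ k * (F.real C + 1 / m) := by gcongr
  have h7 : (k : ℝ) * (F.real C - 1 / m) ≤ k * F.real (H j) := by gcongr
  rw [abs_le]
  constructor <;> linarith

end GlivenkoCantelli

/-! ### Departures compared with the convolution of the entry process -/

section Departures

/-- The service times with which the `(i+1)`-st customer to enter has left by time `t`. -/
def departureSet (A : ℝ≥0 → ℕ) (t : ℝ≥0) (i : ℕ) : Set ℝ≥0 :=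
  {x | x ≤ t ∧ i < A (t - x)}

theorem isLowerSet_departureSet {A : ℝ≥0 → ℕ} (hA : Monotone A) (t : ℝ≥0) (i : ℕ) :
    IsLowerSet (departureSet A t i) := fun _ _ hba ha =>
  ⟨hba.trans ha.1, ha.2.trans_le (hA (tsub_le_tsub_left hba t))⟩

theorem antitone_departureSet (A : ℝ≥0 → ℕ) (t : ℝ≥0) : Antitone (departureSet A t) :=
  fun _ _ hij _ hx => ⟨hx.1, hij.trans_lt hx.2⟩

theorem departureSet_eq_empty {A : ℝ≥0 → ℕ} (hA : Monotone A) {t : ℝ≥0} {i : ℕ} (hi : A t ≤ i) :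
    departureSet A t i = ∅ :=
  Set.eq_empty_of_forall_notMem fun _ hx =>
    absurd (hx.2.trans_le (hA tsub_le_self)) (not_lt.2 hi)

/-- A right-continuous integer-valued path is constant just after each time, so the infimum defining
the entry time is attained. The condition `i < A t` keeps that infimum from being over the empty
set, where it would be `0`. -/
theorem entryTime_add_le_iff {A : ℝ≥0 → ℕ} (hA : Monotone A) (hc : IsCadlag A) {t : ℝ≥0} {i : ℕ}
    (hi : i < A t) (x : ℝ≥0) : entryTime A (i + 1) + x ≤ t ↔ x ∈ departureSet A t i := by
  have hne : {u | i + 1 ≤ A u}.Nonempty := ⟨t, hi⟩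
  have hatt : i + 1 ≤ A (entryTime A (i + 1)) := by
    have hev : ∀ᶠ u in 𝓝[≥] entryTime A (i + 1), A u = A (entryTime A (i + 1)) :=
      by
      have := (hc (entryTime A (i + 1))).1.tendsto
      rwa [nhds_discrete, tendsto_pure] at this
    obtain ⟨u, hu, hsub⟩ := (mem_nhdsGE_iff_exists_Ico_subset).1 hev
    obtain ⟨v, hv, hvu⟩ := exists_lt_of_csInf_lt hne hu
    have : A v = A (entryTime A (i + 1)) := hsub ⟨csInf_le (OrderBot.bddBelow _) hv, hvu⟩
    rw [← this]
    exact hv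
  constructor
  · intro h
    have hx : x ≤ t := le_trans le_add_self h
    exact ⟨hx, lt_of_lt_of_le hatt (hA (le_tsub_of_add_le_right h))⟩
  · rintro ⟨hx, h⟩
    have : entryTime A (i + 1) ≤ t - x := csInf_le (OrderBot.bddBelow _) h
    exact (add_le_add_left this x).trans_eq (tsub_add_cancel_of_le hx)

theorem departures_eq_sum {A : ℝ≥0 → ℕ} (hA : Monotone A) (hc : IsCadlag A) (η : ℕ → ℝ≥0)
    {t : ℝ≥0} {m : ℕ} (hm : A t ≤ m) : (departures A η t : ℝ) =
      ∑ i ∈ Finset.range m, (departureSet A t i).indicator (fun _ => (1 : ℝ)) (η i) := by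
  classical
  rw [departures, Nat.cast_sum]
  rw [← Finset.sum_subset (Finset.range_mono hm)]
  · refine Finset.sum_congr rfl fun i hi => ?_
    rw [Set.indicator_apply]
    simp only [entryTime_add_le_iff hA hc (Finset.mem_range.1 hi)]
    split_ifs <;> simp
  · intro i _ hi
    rw [departureSet_eq_empty hA (by simpa using hi), Set.indicator_empty]

/-- Layer-cake identity: `A (t - s)` counts the `i` with `s ∈ departureSet A t i`. Sets with index
at least `A t` are empty, so `m` is free to be a multiple of the block length. -/
theorem convol_natCast_eq_sum {A : ℝ≥0 → ℕ} (hA : Monotone A) (F : Measure ℝ≥0)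
    [IsProbabilityMeasure F] {t : ℝ≥0} {m : ℕ} (hm : A t ≤ m) :
    convol (fun u => (A u : ℝ)) F t = ∑ i ∈ Finset.range m, F.real (departureSet A t i) := by
  classical
  have hmeas := fun i => (isLowerSet_departureSet hA t i).ordConnected.measurableSet
  rw [convol_eq_integral_indicator]
  have : ∀ s, (Set.Iic t).indicator (fun s => (A (t - s) : ℝ)) s =
      ∑ i ∈ Finset.range m, (departureSet A t i).indicator (fun _ => (1 : ℝ)) s := by
    intro s
    by_cases hs : s ≤ t
    · rw [Set.indicator_of_mem (Set.mem_Iic.2 hs)]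
      simp only [Set.indicator_apply, departureSet, Set.mem_ofPred_eq, hs, true_and]
      have hle : A (t - s) ≤ m := (hA tsub_le_self).trans hm
      rw [Finset.sum_boole, show (Finset.range m).filter (fun i => i < A (t - s))
        = Finset.range (A (t - s)) by ext i; simp; omega, Finset.card_range]
    · rw [Set.indicator_of_notMem (mt Set.mem_Iic.1 hs)]
      refine (Finset.sum_eq_zero fun i _ => Set.indicator_of_notMem (fun h => hs h.1) _).symm
  simp only [this]
  rw [integral_finsetSum _ fun i _ => (integrable_const _).indicator (hmeas i)]
  exact Finset.sum_congr rfl fun i _ => integral_indicator_one (hmeas i)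

/-- A block is a difference of two initial segments, so each fixed set costs `2 * γ` there.
Replacing `C i` by its values at the block ends costs `L` times the drop of `F(C i)` across the
block, and these drops telescope. -/
theorem abs_sum_indicator_sub_le {F : Measure ℝ≥0} [IsProbabilityMeasure F] {η : ℕ → ℝ≥0}
    {C : ℕ → Set ℝ≥0} (hC : ∀ i, IsLowerSet (C i)) (hanti : Antitone C) (L b : ℕ) {γ : ℝ}
    (hγ : ∀ k ≤ b * L, ∀ D : Set ℝ≥0, IsLowerSet D → |count η k D - k * F.real D| ≤ γ) :
    |∑ i ∈ Finset.range (b * L), (C i).indicator (fun _ => (1 : ℝ)) (η i)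
      - ∑ i ∈ Finset.range (b * L), F.real (C i)| ≤ 2 * b * γ + L * (1 - F.real (C (b * L))) := by
  induction b with
  | zero =>
    have : F.real (C 0) ≤ 1 := measureReal_le_one
    have : 0 ≤ (L : ℝ) * (1 - F.real (C 0)) := mul_nonneg (by positivity) (by linarith)
    simpa using this
  | succ b ih =>
    have hbL : (b + 1) * L = b * L + L := by ring
    have ih := ih fun k hk => hγ k (by omega)
    have block : ∀ D, IsLowerSet D →
        |∑ j ∈ Finset.range L, D.indicator (fun _ => (1 : ℝ)) (η (b * L + j)) - L * F.real D|
          ≤ 2 * γ := by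
      intro D hD
      have h1 := hγ (b * L) (by omega) D hD
      have h2 := hγ ((b + 1) * L) le_rfl D hD
      have h3 : count η ((b + 1) * L) D = count η (b * L) D +
          ∑ j ∈ Finset.range L, D.indicator (fun _ => (1 : ℝ)) (η (b * L + j)) := by
        rw [hbL, count, Finset.sum_range_add]; rfl
      have h4 : (((b + 1) * L : ℕ) : ℝ) = (b * L : ℕ) + L := by rw [hbL]; push_cast; ring
      rw [h3, h4] at h2
      rw [abs_le] at *
      constructor <;> linarith
    have hup : ∑ j ∈ Finset.range L, (C (b * L + j)).indicator (fun _ => (1 : ℝ)) (η (b * L + j))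
        ≤ ∑ j ∈ Finset.range L, (C (b * L)).indicator (fun _ => (1 : ℝ)) (η (b * L + j)) :=
      Finset.sum_le_sum fun j _ => Set.indicator_le_indicator_of_subset
        (hanti (by omega)) (fun _ => zero_le_one) _
    have hlo : ∑ j ∈ Finset.range L, (C ((b + 1) * L)).indicator (fun _ => (1 : ℝ)) (η (b * L + j))
        ≤ ∑ j ∈ Finset.range L, (C (b * L + j)).indicator (fun _ => (1 : ℝ)) (η (b * L + j)) :=
      Finset.sum_le_sum fun j hj => Set.indicator_le_indicator_of_subset
        (hanti (by have := Finset.mem_range.1 hj; omega)) (fun _ => zero_le_one) _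
    have hFup : ∑ j ∈ Finset.range L, F.real (C (b * L + j)) ≤ L * F.real (C (b * L)) := by
      refine (Finset.sum_le_card_nsmul _ _ (F.real (C (b * L))) fun j _ =>
        measureReal_mono (hanti (by omega))).trans_eq ?_
      simp
    have hFlo : L * F.real (C ((b + 1) * L)) ≤ ∑ j ∈ Finset.range L, F.real (C (b * L + j)) := by
      refine le_trans (le_of_eq ?_) (Finset.card_nsmul_le_sum _ _ (F.real (C ((b + 1) * L)))
        fun j hj => measureReal_mono (hanti (by have := Finset.mem_range.1 hj; omega)))
      simp
    have b1 := block _ (hC (b * L))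
    have b2 := block _ (hC ((b + 1) * L))
    have e1 : ∀ f : ℕ → ℝ, ∑ i ∈ Finset.range ((b + 1) * L), f i =
        ∑ i ∈ Finset.range (b * L), f i + ∑ j ∈ Finset.range L, f (b * L + j) := fun f => by
      rw [hbL, Finset.sum_range_add]
    rw [e1, e1]
    push_cast
    rw [abs_le] at *
    constructor <;> linarith

/-- The departure process is close to its fluid counterpart, uniformly over entry processes. -/
theorem withHighProb_departures {Ω : Type*} [MeasurableSpace Ω] {P : Measure Ω}
    [IsProbabilityMeasure P] {F : Measure ℝ≥0} [IsProbabilityMeasure F] {η : ℕ → Ω → ℝ≥0}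
    (hη : ∀ i, Measurable (η i)) (hind : iIndepFun η P) (hlaw : ∀ i, P.map (η i) = F) (K : ℕ)
    {ε : ℝ} (hε : 0 < ε) :
    WithHighProb P fun n ω => ∀ A : ℝ≥0 → ℕ, Monotone A → IsCadlag A → ∀ t, A t ≤ K * n →
      |(departures A (fun i => η i ω) t : ℝ) - convol (fun u => (A u : ℝ)) F t| ≤ ε * n := by
  -- With block length `L = n / p + 1` and `n ≥ p`, `n ≤ p * L ≤ 2 * n`. So `K * p` blocks cover `K
  -- * n` indices without passing `2 * K * n`, and `L ≤ 2 * n / p ≤ ε / 2 * n`.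
  obtain ⟨p, hp⟩ := exists_nat_gt (4 / ε)
  have hp0' : (0 : ℝ) < p := lt_trans (by positivity) hp
  have hp0 : 0 < p := by exact_mod_cast hp0'
  -- The `K * p` blocks cost `2 * δ * n` each, in total at most `ε / 2 * n`.
  let δ : ℝ := ε / (4 * (K * p + 1))
  have hδ : 0 < δ := by positivity
  refine (withHighProb_count hη hind hlaw (2 * K) hδ).mono ?_
  filter_upwards [eventually_ge_atTop p] with n hn
  refine .of_forall fun ω h A hA hc t ht => ?_
  have hn' : (p : ℝ) ≤ n := by exact_mod_cast hn
  set L := n / p + 1 with hL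
  have hpL : n ≤ p * L := (Nat.lt_mul_div_succ n hp0).le
  have hLn : p * L ≤ 2 * n := by
    have := Nat.mul_div_le n p
    rw [hL, mul_add]
    omega
  have hLn' : (p : ℝ) * L ≤ 2 * n := by exact_mod_cast hLn
  have hm : A t ≤ K * p * L := ht.trans (by rw [mul_assoc]; gcongr)
  have key := abs_sum_indicator_sub_le (F := F) (η := fun i => η i ω)
    (isLowerSet_departureSet hA t) (antitone_departureSet A t) L (K * p) (γ := δ * n)
    (fun k hk => h k (hk.trans (by
      calc K * p * L = K * (p * L) := by ring
        _ ≤ K * (2 * n) := by gcongr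
        _ = 2 * K * n := by ring)))
  rw [← departures_eq_sum hA hc _ hm, ← convol_natCast_eq_sum hA F hm] at key
  refine key.trans ?_
  have h1 : (L : ℝ) * (1 - F.real (departureSet A t (K * p * L))) ≤ L := by
    refine mul_le_of_le_one_right (by positivity) ?_
    have : 0 ≤ F.real (departureSet A t (K * p * L)) := measureReal_nonneg
    linarith
  have h2 : (L : ℝ) ≤ ε / 2 * n := by
    rw [div_lt_iff₀ hε] at hp
    have : (4 : ℝ) * L ≤ (p * ε) * L := by gcongr
    have : ε * (p * L) ≤ ε * (2 * n) := by gcongr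
    linarith
  have h3 : 2 * ((K * p : ℕ) : ℝ) * (δ * n) ≤ ε / 2 * n := by
    have : 2 * ((K * p : ℕ) : ℝ) * δ ≤ ε / 2 := by
      simp only [δ]
      push_cast
      rw [mul_div_assoc', div_le_iff₀ (by positivity)]
      nlinarith
    calc _ = 2 * ((K * p : ℕ) : ℝ) * δ * n := by ring
      _ ≤ _ := by gcongr
  linarith

end Departures

end ManyServerQueue

namespace ManyServerQueue

/-! ### Customers initially in service -/

section StillInService

theorem count_le (η : ℕ → ℝ≥0) (k : ℕ) (C : Set ℝ≥0) : count η k C ≤ k := by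
  refine (Finset.sum_le_card_nsmul _ _ 1 fun i _ => ?_).trans_eq (by simp)
  exact Set.indicator_le_self' (fun _ _ => zero_le_one) _

theorem abs_count_sub_count_le (η : ℕ → ℝ≥0) (k l : ℕ) (C : Set ℝ≥0) :
    |count η k C - count η l C| ≤ |(k : ℝ) - l| := by
  wlog h : l ≤ k generalizing k l
  · rw [abs_sub_comm, abs_sub_comm (k : ℝ)]
    exact this l k (le_of_not_ge h)
  obtain ⟨d, rfl⟩ := Nat.exists_eq_add_of_le h
  have h1 : count η (l + d) C = count η l C + count (fun i => η (l + i)) d C := by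
    rw [count, Finset.sum_range_add]; rfl
  have h2 : 0 ≤ count (fun i => η (l + i)) d C :=
    Finset.sum_nonneg fun _ _ => Set.indicator_nonneg (fun _ _ => zero_le_one) _
  rw [h1, add_sub_cancel_left, abs_of_nonneg h2]
  push_cast
  rw [add_sub_cancel_left]
  exact (count_le _ _ _).trans (le_abs_self _)

theorem stillInService_eq (η : ℕ → ℝ≥0) (k : ℕ) (t : ℝ≥0) :
    (stillInService k η t : ℝ) = k - count η k (Set.Iic t) := by
  classical
  have : ((k : ℕ) : ℝ) = ∑ _i ∈ Finset.range k, (1 : ℝ) := by simp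
  rw [stillInService, count, this, ← Finset.sum_sub_distrib, Nat.cast_sum]
  refine Finset.sum_congr rfl fun i _ => ?_
  by_cases h : t < η i
  · simp [h, h.not_ge]
  · simp [h, not_lt.1 h]

theorem empiricalCDF_eq (η : ℕ → ℝ≥0) (n : ℕ) (t : ℝ≥0) :
    empiricalCDF n η t = count η n (Set.Iic t) / n := by
  classical
  simp [empiricalCDF, count, Set.indicator_apply]

theorem withHighProb_stillInService {Ω : Type*} [MeasurableSpace Ω] {P : Measure Ω}
    {Ft : Measure ℝ≥0} [IsProbabilityMeasure Ft] {ηt : ℕ → Ω → ℝ≥0} {Qt₀ : ℕ → Ω → ℕ}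
    {qt₀ : ℝ≥0}
    (lim_Qt₀ : TendstoInMeasure P (fun n ω => (Qt₀ n ω : ℝ) / n) atTop fun _ => (qt₀ : ℝ))
    (lim_Ft : TendstoUCP P (fun n ω t => empiricalCDF n (fun i => ηt i ω) t) (distFun Ft))
    {T : ℝ≥0} (hT : 0 < T) {ε : ℝ} (hε : 0 < ε) :
    WithHighProb P fun n ω => ∀ t ≤ T,
      |(stillInService (Qt₀ n ω) (fun i => ηt i ω) t : ℝ) / n - qt₀ * (1 - distFun Ft t)| ≤ ε := by
  -- The hypothesis on empirical distributions is used along the deterministic sample size `κ n ~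
  -- qt₀ * n`; passing to the random size `Qt₀ n` then changes counts by at most `|Qt₀ n - κ n| =
  -- o(n)`.
  let κ : ℕ → ℕ := fun n => ⌊(qt₀ : ℝ) * n⌋₊
  have hκ : Tendsto (fun n : ℕ => (κ n : ℝ) / n) atTop (𝓝 qt₀) :=
    (tendsto_nat_floor_mul_div_atTop qt₀.2).comp tendsto_natCast_atTop_atTop
  have hemp : WithHighProb P fun n ω => ∀ t ≤ T,
      |count (fun i => ηt i ω) (κ n) (Set.Iic t) - κ n * distFun Ft t| ≤ ε / 8 * n := by
    -- For `qt₀ = 0` the sample size does not tend to infinity, but the counts are then empty sums.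
    rcases eq_or_ne qt₀ 0 with h0 | h0
    · refine withHighProb_true.mono (.of_forall fun n => .of_forall fun ω _ t _ => ?_)
      have : κ n = 0 := by simp [κ, h0]
      rw [this]
      simpa [count] using by positivity
    · have hq : (0 : ℝ) < qt₀ := NNReal.coe_pos.2 (pos_iff_ne_zero.2 h0)
      have hκ' : Tendsto κ atTop atTop :=
        tendsto_nat_floor_atTop.comp (tendsto_natCast_atTop_atTop.const_mul_atTop hq)
      let δ : ℝ := ε / 8 / (qt₀ + 1)
      have hδ : 0 < δ := by positivity
      have := (tendstoUCP_iff.1 lim_Ft T hT δ hδ).comp hκ'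
      refine WithHighProb.mono (p := fun n ω => ∀ t ≤ T,
        |empiricalCDF (κ n) (fun i => ηt i ω) t - distFun Ft t| ≤ δ) this ?_
      filter_upwards [hκ'.eventually_gt_atTop 0] with n hn
      refine .of_forall fun ω h t ht => ?_
      have hκ0 : (0 : ℝ) < κ n := by exact_mod_cast hn
      have hκn : (κ n : ℝ) ≤ qt₀ * n := Nat.floor_le (by positivity)
      have h1 := h t ht
      rw [empiricalCDF_eq] at h1
      have h2 : count (fun i => ηt i ω) (κ n) (Set.Iic t) - κ n * distFun Ft t
          = κ n * (count (fun i => ηt i ω) (κ n) (Set.Iic t) / κ n - distFun Ft t) := by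
        field_simp
      rw [h2, abs_mul, abs_of_pos hκ0]
      calc _ ≤ (qt₀ * n) * δ := by gcongr
        _ ≤ ((qt₀ + 1) * n) * δ := by gcongr; linarith
        _ = ε / 8 * n := by simp only [δ]; field_simp
  have hQ := withHighProb_of_tendstoInMeasure lim_Qt₀ (ε := ε / 8) (by positivity)
  refine (hemp.and hQ).mono ?_
  filter_upwards [eventually_gt_atTop 0,
    Metric.tendsto_nhds.1 hκ (ε / 8) (by positivity)] with n hn hκn
  refine .of_forall fun ω ⟨h1, h2⟩ t ht => ?_
  have hn' : (0 : ℝ) < n := by exact_mod_cast hn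
  have h1 := h1 t ht
  have h3 := abs_count_sub_count_le (fun i => ηt i ω) (Qt₀ n ω) (κ n) (Set.Iic t)
  rw [Real.dist_eq] at hκn
  rw [stillInService_eq]
  set a := count (fun i => ηt i ω) (Qt₀ n ω) (Set.Iic t)
  set b := count (fun i => ηt i ω) (κ n) (Set.Iic t)
  have hf0 := distFun_nonneg (F := Ft) t
  have hf1 := distFun_le_one (F := Ft) t
  have h4 : |(κ n : ℝ) / n - qt₀| * distFun Ft t ≤ ε / 8 :=
    (mul_le_of_le_one_right (abs_nonneg _) hf1).trans hκn.le
  have h1' : |b / n - κ n / n * distFun Ft t| ≤ ε / 8 := by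
    rw [show b / n - κ n / n * distFun Ft t = (b - κ n * distFun Ft t) / n by ring, abs_div,
      abs_of_pos hn', div_le_iff₀ hn']
    exact h1
  have h3' : |a / n - b / n| ≤ |(Qt₀ n ω : ℝ) / n - κ n / n| := by
    rw [← sub_div, ← sub_div, abs_div, abs_div]
    gcongr
  have h5 : |(Qt₀ n ω : ℝ) / n - κ n / n| ≤ ε / 8 + ε / 8 := by
    rw [abs_le, abs_lt] at *
    constructor <;> linarith
  have h3'' := h3'.trans h5
  nth_rw 1 [← abs_of_nonneg hf0] at h4
  rw [← abs_mul, sub_mul] at h4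
  rw [sub_div, mul_sub, mul_one]
  rw [abs_le] at *
  constructor <;> linarith

end StillInService

/-! ### Convergence of the scaled queue by Volterra stability -/

section Convergence

variable {Ω : Type*} [MeasurableSpace Ω] {P : Measure Ω} [IsProbabilityMeasure P]

theorem posPart_natCast_sub_div {n : ℕ} (hn : 0 < n) (m : ℕ) :
    max ((m : ℝ) - n) 0 / n = max ((m : ℝ) / n - 1) 0 := by
  have hn' : (0 : ℝ) < n := by exact_mod_cast hn
  rw [← max_div_div_right hn'.le, sub_div, div_self hn'.ne', zero_div]

theorem exists_error_tolerance {F : Measure ℝ≥0} [IsProbabilityMeasure F]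
    (hF : F (Set.Iic 0) < 1) (T : ℝ≥0) {ε : ℝ} (hε : 0 < ε) :
    ∃ ζ : ℝ, 0 < ζ ∧ Real.exp T / (1 - laplaceOne F) * ζ ≤ ε := by
  have h := sub_pos.2 (laplaceOne_lt_one hF)
  have hc : 0 < Real.exp T / (1 - laplaceOne F) := div_pos (Real.exp_pos _) h
  exact ⟨ε / (Real.exp T / (1 - laplaceOne F)), by positivity, by field_simp; rfl⟩

/-- Convergence of the number of initial customers still present. -/
theorem tendstoUCP_initial {Fh Ft : Measure ℝ≥0} [IsProbabilityMeasure Fh]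
    [IsProbabilityMeasure Ft] (hFh : Fh (Set.Iic 0) < 1) {ηh ηt : ℕ → Ω → ℝ≥0}
    {Qh₀ Qt₀ : ℕ → Ω → ℕ} (ηh_meas : ∀ i, Measurable (ηh i)) (ηh_indep : iIndepFun ηh P)
    (ηh_law : ∀ i, P.map (ηh i) = Fh) {Qh Ah : ℕ → Ω → ℝ≥0 → ℕ}
    (path : ∀ n, 0 < n → ∀ᵐ ω ∂P, IsCadlag (Qh n ω) ∧ IsCadlag (Ah n ω) ∧ Monotone (Ah n ω) ∧
      (∀ t, (Qh n ω t : ℝ) = Qh₀ n ω + stillInService (Qt₀ n ω) (fun i => ηt i ω) t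
        - departures (Ah n ω) (fun i => ηh i ω) t) ∧
      ∀ t, (Ah n ω t : ℝ) = Qh₀ n ω - max ((Qh n ω t : ℝ) - n) 0)
    {qh₀ qt₀ : ℝ≥0}
    (lim_Qh₀ : TendstoInMeasure P (fun n ω => (Qh₀ n ω : ℝ) / n) atTop fun _ => (qh₀ : ℝ))
    (lim_Qt₀ : TendstoInMeasure P (fun n ω => (Qt₀ n ω : ℝ) / n) atTop fun _ => (qt₀ : ℝ))
    (lim_Ft : TendstoUCP P (fun n ω t => empiricalCDF n (fun i => ηt i ω) t) (distFun Ft))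
    {qh : ℝ≥0 → ℝ} (hqh : IsCadlag qh)
    (eq_qh : ∀ t, qh t = qh₀ * (1 - distFun Fh t) + qt₀ * (1 - distFun Ft t)
      + convol (fun u => max (qh u - 1) 0) Fh t) :
    TendstoUCP P (fun n ω t => (Qh n ω t : ℝ) / n) qh := by
  rw [tendstoUCP_iff]
  intro T hT ε hε
  obtain ⟨ζ, hζ, hζε⟩ := exists_error_tolerance hFh T hε
  -- Bounds the entries: `Ah ≤ Qh₀ ≤ K * n` on the good event.
  obtain ⟨K, hK⟩ := exists_nat_gt ((qh₀ : ℝ) + ζ)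
  refine ((withHighProb_of_tendstoInMeasure lim_Qh₀ (ε := ζ / 3) (by positivity)).and
    ((withHighProb_stillInService lim_Qt₀ lim_Ft hT (ε := ζ / 3) (by positivity)).and
    (withHighProb_departures ηh_meas ηh_indep ηh_law K (ε := ζ / 3) (by positivity)))).mono ?_
  filter_upwards [eventually_gt_atTop 0] with n hn
  filter_upwards [path n hn] with ω ⟨cQ, cA, mA, eQ, eA⟩ ⟨h0, hs, hd⟩
  have hn' : (0 : ℝ) < n := by exact_mod_cast hn
  intro t ht
  have cq := cQ.natCast.div_const n
  refine (volterra_stability hFh cq hqh (fun u hu => ?_) ht).trans hζε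
  have hAK : Ah n ω u ≤ K * n := by
    have h1 : (Ah n ω u : ℝ) ≤ Qh₀ n ω := by
      rw [eA]; linarith [le_max_right ((Qh n ω u : ℝ) - n) 0]
    have h2 : (Qh₀ n ω : ℝ) / n ≤ K := by
      have := (abs_le.1 h0).2
      linarith
    rw [div_le_iff₀ hn'] at h2
    exact_mod_cast h1.trans h2
  have hs := hs u hu
  have hd : |(departures (Ah n ω) (fun i => ηh i ω) u : ℝ) / n
      - convol (fun u => (Ah n ω u : ℝ) / n) Fh u| ≤ ζ / 3 := by
    rw [convol_div_const, ← sub_div, abs_div, abs_of_pos hn', div_le_iff₀ hn']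
    exact hd _ mA cA u hAK
  -- Eliminating the entry process exposes the Volterra term in `Qh / n`; what remains is the
  -- forcing term, which differs from the fluid one by three errors of size `ζ / 3`.
  have hconv : convol (fun u => (Ah n ω u : ℝ) / n) Fh u = (Qh₀ n ω : ℝ) / n * distFun Fh u
      - convol (fun u => max ((Qh n ω u : ℝ) / n - 1) 0) Fh u := by
    rw [← convol_const, ← convol_sub (isCadlag_const _) cq.posPart_sub_one]
    congr 1
    funext v
    rw [eA, sub_div, posPart_natCast_sub_div hn]
  rw [hconv] at hd
  have hq := eq_qh u
  have eQ' : (Qh n ω u : ℝ) / n = (Qh₀ n ω : ℝ) / n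
      + (stillInService (Qt₀ n ω) (fun i => ηt i ω) u : ℝ) / n
      - (departures (Ah n ω) (fun i => ηh i ω) u : ℝ) / n := by
    rw [eQ]; ring
  have hf0 := distFun_nonneg (F := Fh) u
  have hf1 := distFun_le_one (F := Fh) u
  have h0' : |((Qh₀ n ω : ℝ) / n - qh₀) * (1 - distFun Fh u)| ≤ ζ / 3 := by
    rw [abs_mul, abs_of_nonneg (by linarith : 0 ≤ 1 - distFun Fh u)]
    exact (mul_le_of_le_one_right (abs_nonneg _) (by linarith)).trans h0
  rw [sub_mul, mul_sub, mul_one] at h0'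
  rw [eQ', hq]
  rw [abs_le] at *
  constructor <;> linarith

/-- Convergence of the total number of customers, given that of the initial ones. -/
theorem tendstoUCP_total {F : Measure ℝ≥0} [IsProbabilityMeasure F] (hF : F (Set.Iic 0) < 1)
    {η : ℕ → Ω → ℝ≥0} (η_meas : ∀ i, Measurable (η i)) (η_indep : iIndepFun η P)
    (η_law : ∀ i, P.map (η i) = F) {E Q Qh Ac : ℕ → Ω → ℝ≥0 → ℕ}
    (path : ∀ n, 0 < n → ∀ᵐ ω ∂P, IsCadlag (E n ω) ∧ IsCadlag (Qh n ω) ∧ IsCadlag (Q n ω) ∧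
      IsCadlag (Ac n ω) ∧ Monotone (Ac n ω) ∧
      (∀ t, (Q n ω t : ℝ) = Qh n ω t + E n ω t - departures (Ac n ω) (fun i => η i ω) t) ∧
      ∀ t, (Ac n ω t : ℝ) = E n ω t + max ((Qh n ω t : ℝ) - n) 0 - max ((Q n ω t : ℝ) - n) 0)
    {e q qh : ℝ≥0 → ℝ} (he : IsCadlag e) (hq : IsCadlag q) (hqh : IsCadlag qh)
    (lim_E : TendstoUCP P (fun n ω t => (E n ω t : ℝ) / n) e)
    (lim_Qh : TendstoUCP P (fun n ω t => (Qh n ω t : ℝ) / n) qh)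
    (eq_q : ∀ t, q t = e t - convol e F t + qh t - convol (fun u => max (qh u - 1) 0) F t
      + convol (fun u => max (q u - 1) 0) F t) :
    TendstoUCP P (fun n ω t => (Q n ω t : ℝ) / n) q := by
  rw [tendstoUCP_iff]
  intro T hT ε hε
  obtain ⟨ζ, hζ, hζε⟩ := exists_error_tolerance hF T hε
  obtain ⟨Me, -, hMe⟩ := he.exists_bound T
  obtain ⟨Mq, -, hMq⟩ := hqh.exists_bound T
  -- On the good event `Ac / n ≤ E / n + Qh / n ≤ Me + Mq + 2 * ζ / 5`.
  obtain ⟨K, hK⟩ := exists_nat_gt (Me + Mq + ζ)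
  refine ((tendstoUCP_iff.1 lim_E T hT (ζ / 5) (by positivity)).and
    ((tendstoUCP_iff.1 lim_Qh T hT (ζ / 5) (by positivity)).and
    (withHighProb_departures η_meas η_indep η_law K (ε := ζ / 5) (by positivity)))).mono ?_
  filter_upwards [eventually_gt_atTop 0] with n hn
  filter_upwards [path n hn] with ω ⟨cE, cQh, cQ, cA, mA, eQ, eA⟩ ⟨hE, hQh, hd⟩
  have hn' : (0 : ℝ) < n := by exact_mod_cast hn
  intro t ht
  have cq := cQ.natCast.div_const n
  have cqh := cQh.natCast.div_const n
  have ce := cE.natCast.div_const n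
  have eA' : ∀ v, (Ac n ω v : ℝ) / n = (E n ω v : ℝ) / n + max ((Qh n ω v : ℝ) / n - 1) 0
      - max ((Q n ω v : ℝ) / n - 1) 0 := fun v => by
    rw [eA, sub_div, add_div, posPart_natCast_sub_div hn, posPart_natCast_sub_div hn]
  refine (volterra_stability hF cq hq (fun u hu => ?_) ht).trans hζε
  have hAK : Ac n ω u ≤ K * n := by
    have h1 : (Ac n ω u : ℝ) / n ≤ K := by
      rw [eA']
      have h2 := (abs_le.1 (hE u hu)).2
      have h3 := (abs_le.1 (hQh u hu)).2
      have h4 := (abs_le.1 (hMe u hu)).2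
      have h5 := (abs_le.1 (hMq u hu)).2
      have h6 : max ((Qh n ω u : ℝ) / n - 1) 0 ≤ (Qh n ω u : ℝ) / n :=
        max_le (by linarith) (by positivity)
      have h7 := le_max_right ((Q n ω u : ℝ) / n - 1) 0
      linarith
    rw [div_le_iff₀ hn'] at h1
    exact_mod_cast h1
  have hd : |(departures (Ac n ω) (fun i => η i ω) u : ℝ) / n
      - convol (fun u => (Ac n ω u : ℝ) / n) F u| ≤ ζ / 5 := by
    rw [convol_div_const, ← sub_div, abs_div, abs_of_pos hn', div_le_iff₀ hn']
    exact hd _ mA cA u hAK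
  have hconv : convol (fun u => (Ac n ω u : ℝ) / n) F u = convol (fun u => (E n ω u : ℝ) / n) F u
      + convol (fun u => max ((Qh n ω u : ℝ) / n - 1) 0) F u
      - convol (fun u => max ((Q n ω u : ℝ) / n - 1) 0) F u := by
    rw [← convol_add ce cqh.posPart_sub_one,
      ← convol_sub (ce.add cqh.posPart_sub_one) cq.posPart_sub_one]
    congr 1
    funext v
    exact eA' v
  rw [hconv] at hd
  -- The arrivals and the initial customers each contribute an error directly and through a
  -- convolution; with the departure error this makes five of size `ζ / 5`.
  have c1 := abs_convol_sub_le (F := F) ce he hE hu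
  have c2 := abs_convol_sub_le (F := F) cqh.posPart_sub_one hqh.posPart_sub_one
    (fun v hv => (abs_posPart_sub_one_sub_le _ _).trans (hQh v hv)) hu
  have h1 := hE u hu
  have h2 := hQh u hu
  have hqu := eq_q u
  have eQ' : (Q n ω u : ℝ) / n = (Qh n ω u : ℝ) / n + (E n ω u : ℝ) / n
      - (departures (Ac n ω) (fun i => η i ω) u : ℝ) / n := by
    rw [eQ]; ring
  rw [eQ', hqu]
  rw [abs_le] at *
  constructor <;> linarith

end Convergence

end ManyServerQueue

/-! ### The fluid limit theorem -/

theorem theorem2p3 {Ω : Type*} [MeasurableSpace Ω] (P : Measure Ω) [IsProbabilityMeasure P]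
    -- distributions of the service times and the limiting distribution `Ft`
    (F Fh Ft : Measure ℝ≥0) [IsProbabilityMeasure F] [IsProbabilityMeasure Fh]
    [IsProbabilityMeasure Ft]
    (hF : F (Set.Iic 0) < 1) (hFh : Fh (Set.Iic 0) < 1)
    -- primitives
    (η ηh ηt : ℕ → Ω → ℝ≥0) (Qh₀ Qt₀ : ℕ → Ω → ℕ) (E : ℕ → Ω → ℝ≥0 → ℕ)
    (η_meas : ∀ i, Measurable (η i)) (ηh_meas : ∀ i, Measurable (ηh i))
    (ηt_meas : ∀ i, Measurable (ηt i))
    (Qh₀_meas : ∀ n, Measurable (Qh₀ n)) (Qt₀_meas : ∀ n, Measurable (Qt₀ n))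
    (E_meas : ∀ n t, Measurable fun ω => E n ω t)
    (η_indep : iIndepFun η P) (η_law : ∀ i, P.map (η i) = F)
    (ηh_indep : iIndepFun ηh P) (ηh_law : ∀ i, P.map (ηh i) = Fh)
    (E_path : ∀ n, 0 < n → ∀ᵐ ω ∂P, Monotone (E n ω) ∧ IsCadlag (E n ω))
    (indep : ∀ n, 0 < n → iIndep
      ![MeasurableSpace.comap (Qt₀ n) inferInstance,
        MeasurableSpace.comap (Qh₀ n) inferInstance,
        MeasurableSpace.comap (fun ω i => ηt i ω) inferInstance,
        MeasurableSpace.comap (fun ω i => ηh i ω) inferInstance,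
        MeasurableSpace.comap (fun ω i => η i ω) inferInstance,
        MeasurableSpace.comap (fun ω => E n ω) inferInstance] P)
    -- the queueing processes: any solutions of the queueing equations
    (Q Qh Ac Ah : ℕ → Ω → ℝ≥0 → ℕ)
    (Q_meas : ∀ n t, Measurable fun ω => Q n ω t)
    (Qh_meas : ∀ n t, Measurable fun ω => Qh n ω t)
    (Ac_meas : ∀ n t, Measurable fun ω => Ac n ω t)
    (Ah_meas : ∀ n t, Measurable fun ω => Ah n ω t)
    (queue : ∀ n, 0 < n → ∀ᵐ ω ∂P, IsQueuePath n (E n ω) (Qh₀ n ω) (Qt₀ n ω)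
      (fun i => η i ω) (fun i => ηh i ω) (fun i => ηt i ω) (Q n ω) (Qh n ω) (Ac n ω) (Ah n ω))
    -- fluid data and the convergence hypotheses
    (e : ℝ≥0 → ℝ) (e_mono : Monotone e) (e_cadlag : IsCadlag e) (qh₀ qt₀ : ℝ≥0)
    (lim_Qh₀ : TendstoInMeasure P (fun n ω => (Qh₀ n ω : ℝ) / n) atTop fun _ => (qh₀ : ℝ))
    (lim_Qt₀ : TendstoInMeasure P (fun n ω => (Qt₀ n ω : ℝ) / n) atTop fun _ => (qt₀ : ℝ))
    (lim_Ft : TendstoUCP P (fun n ω t => empiricalCDF n (fun i => ηt i ω) t) (distFun Ft))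
    (lim_E : TendstoUCP P (fun n ω t => (E n ω t : ℝ) / n) e) :
    ∃ q qh : ℝ≥0 → ℝ,
      IsFluidSolution e qh₀ qt₀ F Fh Ft q qh ∧
      (∀ q' qh' : ℝ≥0 → ℝ, IsFluidSolution e qh₀ qt₀ F Fh Ft q' qh' → q' = q ∧ qh' = qh) ∧
      TendstoUCP P (fun n ω t => (Q n ω t : ℝ) / n) q ∧
      TendstoUCP P (fun n ω t => (Qh n ω t : ℝ) / n) qh ∧
      TendstoUCP P (fun n ω t => (Ac n ω t : ℝ) / n)
        (fun t => e t + max (qh t - 1) 0 - max (q t - 1) 0) ∧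
      TendstoUCP P (fun n ω t => (Ah n ω t : ℝ) / n)
        (fun t => qh₀ - max (qh t - 1) 0) := by
  have cz : IsCadlag fun t => (qh₀ : ℝ) * (1 - distFun Fh t) + qt₀ * (1 - distFun Ft t) :=
    (((isCadlag_const 1).sub isCadlag_distFun).const_mul _).add
      (((isCadlag_const 1).sub isCadlag_distFun).const_mul _)
  obtain ⟨qh, cqh, eq_qh⟩ := volterra_exists hFh cz
  -- The forcing term is `e - e * F + qh - (qh - 1)⁺ * F`, with `*` denoting convolution, known once
  -- `qh` has been constructed.
  obtain ⟨q, cq, eq_q⟩ := volterra_exists hF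
    (((e_cadlag.sub (e_cadlag.convol (F := F))).add cqh).sub
      (cqh.posPart_sub_one.convol (F := F)))
  have lim_Qh : TendstoUCP P (fun n ω t => (Qh n ω t : ℝ) / n) qh :=
    tendstoUCP_initial hFh ηh_meas ηh_indep ηh_law (Ah := Ah)
      (fun n hn => (queue n hn).mono fun ω h =>
        ⟨h.cadlag_Qh, h.cadlag_Ah, h.monotone_Ah, h.eq_Qh, h.eq_Ah⟩)
      lim_Qh₀ lim_Qt₀ lim_Ft cqh eq_qh
  have lim_Q : TendstoUCP P (fun n ω t => (Q n ω t : ℝ) / n) q :=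
    tendstoUCP_total hF η_meas η_indep η_law (Ac := Ac)
      (fun n hn => by
        filter_upwards [queue n hn, E_path n hn] with ω h hE
        exact ⟨hE.2, h.cadlag_Qh, h.cadlag_Q, h.cadlag_Ac, h.monotone_Ac, h.eq_Q, h.eq_Ac⟩)
      e_cadlag cq cqh lim_E lim_Qh eq_q
  refine ⟨q, qh, ⟨cq, cqh, eq_q, eq_qh⟩, ?_, lim_Q, lim_Qh, ?_, ?_⟩
  · intro q' qh' h
    obtain rfl := volterra_unique hFh h.cadlag_qh cqh h.eq_qh eq_qh
    exact ⟨volterra_unique hF h.cadlag_q cq h.eq_q eq_q, rfl⟩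
  · rw [tendstoUCP_iff] at *
    intro T hT ε hε
    refine ((lim_E T hT (ε / 3) (by positivity)).and ((lim_Qh T hT (ε / 3) (by positivity)).and
      (lim_Q T hT (ε / 3) (by positivity)))).mono ?_
    filter_upwards [eventually_gt_atTop 0] with n hn
    filter_upwards [queue n hn] with ω h ⟨hE, hQh, hQ⟩ t ht
    have h1 := hE t ht
    have h2 := (abs_posPart_sub_one_sub_le _ _).trans (hQh t ht)
    have h3 := (abs_posPart_sub_one_sub_le _ _).trans (hQ t ht)
    rw [h.eq_Ac, sub_div, add_div, posPart_natCast_sub_div hn, posPart_natCast_sub_div hn]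
    rw [abs_le] at *
    constructor <;> linarith
  · rw [tendstoUCP_iff] at *
    intro T hT ε hε
    refine ((withHighProb_of_tendstoInMeasure lim_Qh₀ (ε := ε / 2) (by positivity)).and
      (lim_Qh T hT (ε / 2) (by positivity))).mono ?_
    filter_upwards [eventually_gt_atTop 0] with n hn
    filter_upwards [queue n hn] with ω h ⟨h0, hQh⟩ t ht
    have h2 := (abs_posPart_sub_one_sub_le _ _).trans (hQh t ht)
    rw [h.eq_Ah, sub_div, posPart_natCast_sub_div hn]
    rw [abs_le] at *
    constructor <;> linarith
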